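/- Let $H$ be a real Hilbert space, $\mathsf A:H\to 2^H$ a maximal monotone operator with $S:=\mathsf A^{-1}(0)\neq\emptyset$, and for $\sigma>0$ let $J_\sigma=(I+\sigma\mathsf A)^{-1}:H\to H$ be its resolvent. Let $u,z_0\in H$, $(e_n)\subset H$, $(c_n)\subset(0,\infty)$, $(\lambda_n),(\delta_n)\subset(0,1)$, $(\gamma_n)\subset[0,1)$ with $\lambda_n+\gamma_n+\delta_n=1$ for all $n$, and let $(z_n)$, $(y_n)$ be given by $y_0=z_0$ and $$z_{n+1}=\lambda_nu+\gamma_nz_n+\delta_nJ_{c_n}(z_n)+e_n,\qquad y_{n+1}=\lambda_nu+\gamma_ny_n+\delta_nJ_{c_n}(y_n)\qquad(n\in\mathbb N).$$ Call $g:\mathbb N\to\mathbb N$ monotone if $g(n)\le g(n+1)$ for all $n$. Assume that $c\in\mathbb N\setminus\{0\}$ and monotone functions $\ell,L,E:\mathbb N\to\mathbb N$ and $h:\mathbb N\to\mathbb N\setminus\{0\}$ satisfy * $\lambda_n\ge \frac1{h(n)}$ for all $n$; * $\lambda_n\le\frac1{k+1}$ for all $k$ and all $n\ge\ell(k)$;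 * $\sum_{i=1}^{L(k)}\lambda_i\ge k$ for all $k$; * $\min\{c_n,\delta_n^2\}\ge\frac1c$ for all $n$; * either $\sum_{i=E(k)+1}^{E(k)+n}\|e_i\|\le\frac1{k+1}$ for all $k,n$, or $\frac{\|e_n\|}{\lambda_n}\le\frac1{k+1}$ for all $k$ and all $n\ge E(k)$. Let $\mathsf C:\mathbb N\to\mathbb N$ be monotone with $c_n\le\mathsf C(n)$ for all $n$. Let $D,d_0,d_1,d_2\in\mathbb N\setminus\{0\}$ be such that $D\ge\max\{2\|u-p\|,\|z_0-p\|\}$ for some $p\in S$, $d_0\ge\max\{\|u-p\|,\|z_0-p\|\}$ for some $p\in S$, $d_1\ge\sum_{i=0}^{E(0)}\|e_i\|+1$ and $d_2\ge\max\{\|z_i-y_i\|:i\le E(0)\}$. For $k,m,n\in\mathbb N$ and $f,g:\mathbb N\to\mathbb N$ put (with $g^{(j)}$ the $j$-th iterate of $g$, and with $f+a$ the function $m\mapsto f(m)+a$) * $\zeta(k,n)=c(k+1)\mathsf C(n)-1$, $\ \overline\sigma(k,n)=L\big(n+\lceil\ln(12D^2(k+1))\rceil\big)+1$; * $\phi_2(k,n,g)=\max\{n,g^{(4D^2(k+1))}(n)\}$,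 $\ \phi_1(k,n,g)=g(\phi_2(k,n,g))$; * $\beta(k,g)=24D\big(w_g^{(R)}(0)+1\big)^2$, where $R=4D^4(k+1)^2$ and $w_g(m)=\max\{g(24D(m+1)^2),\,24D(m+1)^2\}$; and, for given $k$ and $f$, * $\widetilde f(n)=f(\overline\sigma(k,n))$, $\ r_1(n)=12c(n+1)^2-1$, $\ r_2(n)=\max\{2(n+1),128D(k+1)^2\}$; * $r_3(n)=\ell\big(\max\{96cD^2(n+1)^2-1,\ 256D^2(k+1)^2-1,\ 16c\,(r_2(n))^2D^2\}\big)$; * $r_4(n)=3(k+1)\big(\widetilde f(\phi_2(r_1(n),r_3(n),\widetilde f+2))+1\big)$, $\ \Phi(n)=\phi_1(r_1(n),r_3(n),\widetilde f+2)$; * $\Xi_1(n)=\zeta\big(2(6D+1)\max\{r_1(n),r_4(n)\}-1,\ \phi_1(r_1(n),r_3(n),\widetilde f+2)\big)$; * $\xi(n)=\zeta\big(\max\{16h(f(n))(k+1)^2(6D+1),\ 4c\,(r_2(n))^2(6D+1)\},\ f(n)\big)$, $\ \Xi_2(n)=\xi(\Phi(n))$, $\ \Xi(n)=\max\{\Xi_1(n),\Xi_2(n)\}$;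 * $\mu(k,f)=\max\{\overline\sigma(k,\phi_2(r_1(b),r_3(b),\widetilde f+2)),\ \Phi(b)\}$, where $b=\beta(32(k+1)^2-1,\Xi)$; * $\widetilde\mu(k,f)=\max\{\mu(16c^2(k+1)^2-1,\check f+1),\ \ell(4cD(k+1)-1)\}$, where $\check f(m)=f(\max\{m,\ell(4cD(k+1)-1)\})$; * $\Theta(k)=L\big(E(3k+2)+\lceil\ln(3d(k+1))\rceil\big)+1$, where $d=\max\{2d_0+d_1,d_2\}$; * $\widetilde\nu(k,f)=\max\{\widetilde\mu(2k+1,\breve f),\ \Theta(4k+3)\}$, where $\breve f(m)=f(\max\{m,\Theta(4k+3)\})$. Here all auxiliary functions occurring in a value such as $\mu(k',f')$ are formed from the arguments $k',f'$ at which it is taken. Then for all $k\in\mathbb N$ and all monotone $f:\mathbb N\to\mathbb N$: 1. there is $n\le\widetilde\nu(k,f)$ such that $\|J_{c_i}(z_i)-z_i\|\le\frac1{k+1}$ for all $i\in[n,f(n)]$; 2. there is $n\le\widetilde\nu(2k+1,f)$ such that $\|J_{1/c}(z_i)-z_i\|\le\frac1{k+1}$ for all $i\in[n,f(n)]$, where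 $[n,f(n)]=\{i\in\mathbb N:n\le i\le f(n)\}$ (empty if $f(n)<n$). -/

import Mathlib

namespace MPPA

section Operators

variable {H : Type*} [NormedAddCommGroup H] [InnerProductSpace ℝ H]

/-- A set-valued operator `A : H → 2^H` is monotone. -/
def IsMonotoneOp (A : H → Set H) : Prop :=
  ∀ x y x' y' : H, y ∈ A x → y' ∈ A x' → 0 ≤ inner ℝ (x - x') (y - y')

/-- A monotone operator whose graph is not properly contained in the graph of another
monotone operator. -/
def IsMaximalMonotoneOp (A : H → Set H) : Prop :=
  IsMonotoneOp A ∧ ∀ B : H → Set H, IsMonotoneOp B → (∀ x, A x ⊆ B x) → B = A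

/-- The set `S = A⁻¹(0)` of zeros of `A`. -/
def zeros (A : H → Set H) : Set H := {p | (0 : H) ∈ A p}

/-- The set-valued inverse `(I + σ A)⁻¹`, evaluated at `x`. -/
def resolventSet (A : H → Set H) (σ : ℝ) (x : H) : Set H :=
  {w | ∃ v ∈ A w, w + σ • v = x}

/-- For a monotone operator and `σ > 0`, the inverse `(I + σ A)⁻¹` is at most single-valued. -/
theorem resolventSet_subsingleton {A : H → Set H} (hA : IsMonotoneOp A) {σ : ℝ} (hσ : 0 < σ)
    (x : H) : (resolventSet A σ x).Subsingleton := by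
  rintro w ⟨v, hv, hw⟩ w' ⟨v', hv', hw'⟩
  have h := hA w v w' v' hv hv'
  have e : w - w' = -(σ • (v - v')) := by
    have h1 : w = x - σ • v := by rw [← hw]; abel
    have h2 : w' = x - σ • v' := by rw [← hw']; abel
    rw [h1, h2, smul_sub]; abel
  have h3 : 0 ≤ -(‖w - w'‖ ^ 2) := by
    have h4 : inner ℝ (w - w') (σ • (v - v')) = -(‖w - w'‖ ^ 2) := by
      have h5 : σ • (v - v') = -(w - w') := by rw [e, neg_neg]
      rw [h5, inner_neg_right, real_inner_self_eq_norm_sq]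
    rw [← h4, real_inner_smul_right]
    exact mul_nonneg hσ.le h
  have h6 : ‖w - w'‖ = 0 := by
    have := sq_nonneg ‖w - w'‖
    exact pow_eq_zero_iff (two_ne_zero) |>.1 (by linarith)
  exact sub_eq_zero.1 (norm_eq_zero.1 h6)

/-- The resolvent function `J_σ = (I + σ A)⁻¹`: the value at `x` is the (unique) element of
`(I + σ A)⁻¹ x`; it exists for every `x` when `A` is maximal monotone, `σ > 0` and `H` is
complete. -/
noncomputable def resolvent (A : H → Set H) (σ : ℝ) (x : H) : H :=
  Classical.epsilon fun w => w ∈ resolventSet A σ x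

end Operators

section Bounds

/-- `ζ[c, C](k, n)` -/
def zeta (c : ℕ) (C : ℕ → ℕ) (k n : ℕ) : ℕ := c * (k + 1) * C n - 1

/-- `σ̄[L, D](k, n)` -/
noncomputable def sigmaBar (L : ℕ → ℕ) (D k n : ℕ) : ℕ :=
  L (n + ⌈Real.log (12 * (D : ℝ) ^ 2 * ((k : ℝ) + 1))⌉₊) + 1

/-- `φ₂[D](k, n, f)` -/
def phi2 (D k n : ℕ) (f : ℕ → ℕ) : ℕ := max n (f^[4 * D ^ 2 * (k + 1)] n)

/-- `φ₁[D](k, n, f)` -/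
def phi1 (D k n : ℕ) (f : ℕ → ℕ) : ℕ := f (phi2 D k n f)

/-- `f̃[k, f, L, D]` -/
noncomputable def fTilde (k : ℕ) (f L : ℕ → ℕ) (D n : ℕ) : ℕ := f (sigmaBar L D k n)

/-- the function `f̃ + 2` -/
noncomputable def fTildeTwo (k : ℕ) (f L : ℕ → ℕ) (D n : ℕ) : ℕ := fTilde k f L D n + 2

/-- `r₁[c](n)` -/
def r1 (c n : ℕ) : ℕ := 12 * c * (n + 1) ^ 2 - 1

/-- `r₂[k, D](n)` -/
def r2 (k D n : ℕ) : ℕ := max (2 * (n + 1)) (128 * D * (k + 1) ^ 2)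

/-- `r₃[k, c, ℓ, D](n)` -/
def r3 (k c : ℕ) (l : ℕ → ℕ) (D n : ℕ) : ℕ :=
  l (max (max (96 * c * D ^ 2 * (n + 1) ^ 2 - 1) (256 * D ^ 2 * (k + 1) ^ 2 - 1))
    (16 * c * (r2 k D n) ^ 2 * D ^ 2))

/-- `r₄[k, c, f, ℓ, D, L](n)` -/
noncomputable def r4 (k c : ℕ) (f l : ℕ → ℕ) (D : ℕ) (L : ℕ → ℕ) (n : ℕ) : ℕ :=
  3 * (k + 1) *
    (fTilde k f L D (phi2 D (r1 c n) (r3 k c l D n) (fTildeTwo k f L D)) + 1)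

/-- `Φ[k, c, f, ℓ, L, D](n)` -/
noncomputable def Phi (k c : ℕ) (f l L : ℕ → ℕ) (D n : ℕ) : ℕ :=
  phi1 D (r1 c n) (r3 k c l D n) (fTildeTwo k f L D)

/-- `Ξ₁[k, f, c, C, ℓ, L, D](n)` -/
noncomputable def Xi1 (k : ℕ) (f : ℕ → ℕ) (c : ℕ) (C l L : ℕ → ℕ) (D n : ℕ) : ℕ :=
  zeta c C (2 * (6 * D + 1) * max (r1 c n) (r4 k c f l D L n) - 1)
    (phi1 D (r1 c n) (r3 k c l D n) (fTildeTwo k f L D))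

/-- `ξ[k, f, c, C, ℓ, L, D, h](n)` (it does not depend on `ℓ` and `L`) -/
def xi (k : ℕ) (f : ℕ → ℕ) (c : ℕ) (C : ℕ → ℕ) (D : ℕ) (h : ℕ → ℕ) (n : ℕ) : ℕ :=
  zeta c C
    (max (16 * h (f n) * (k + 1) ^ 2 * (6 * D + 1)) (4 * c * (r2 k D n) ^ 2 * (6 * D + 1)))
    (f n)

/-- `Ξ₂[k, f, c, C, ℓ, L, D, h](n)` -/
noncomputable def Xi2 (k : ℕ) (f : ℕ → ℕ) (c : ℕ) (C l L : ℕ → ℕ) (D : ℕ) (h : ℕ → ℕ)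
    (n : ℕ) : ℕ :=
  xi k f c C D h (Phi k c f l L D n)

/-- `Ξ(n) = max {Ξ₁(n), Ξ₂(n)}` -/
noncomputable def Xi (k : ℕ) (f : ℕ → ℕ) (c : ℕ) (C l L : ℕ → ℕ) (D : ℕ) (h : ℕ → ℕ)
    (n : ℕ) : ℕ :=
  max (Xi1 k f c C l L D n) (Xi2 k f c C l L D h n)

/-- `w_f[D](m)` -/
def wFun (D : ℕ) (f : ℕ → ℕ) (m : ℕ) : ℕ :=
  max (f (24 * D * (m + 1) ^ 2)) (24 * D * (m + 1) ^ 2)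

/-- `β[D](k, f) = 24 D (w_f^{(R)}(0) + 1)²` with `R = 4 D⁴ (k+1)²` -/
def beta (D k : ℕ) (f : ℕ → ℕ) : ℕ :=
  24 * D * ((wFun D f)^[4 * D ^ 4 * (k + 1) ^ 2] 0 + 1) ^ 2

/-- `β(k̄, Ξ)` with `k̄ = 32 (k+1)² - 1` -/
noncomputable def betaXi (c : ℕ) (C l L : ℕ → ℕ) (D : ℕ) (h : ℕ → ℕ) (k : ℕ)
    (f : ℕ → ℕ) : ℕ :=
  beta D (32 * (k + 1) ^ 2 - 1) (Xi k f c C l L D h)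

/-- `μ(k, f) = max {σ̄(k, φ₂(r̄, n̄, f̃ + 2)), Φ(β(k̄, Ξ))}` with `r̄ = r₁(β(k̄, Ξ))` and
`n̄ = r₃(β(k̄, Ξ))` -/
noncomputable def mu (c : ℕ) (C l L : ℕ → ℕ) (D : ℕ) (h : ℕ → ℕ) (k : ℕ)
    (f : ℕ → ℕ) : ℕ :=
  max
    (sigmaBar L D k
      (phi2 D (r1 c (betaXi c C l L D h k f)) (r3 k c l D (betaXi c C l L D h k f))
        (fTildeTwo k f L D)))
    (Phi k c f l L D (betaXi c C l L D h k f))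

/-- `μ̃(k, f) = max {μ(16c²(k+1)² - 1, f̌ + 1), ℓ(4cD(k+1) - 1)}` with
`f̌(m) = f(max {m, ℓ(4cD(k+1) - 1)})` -/
noncomputable def muTilde (c : ℕ) (C l L : ℕ → ℕ) (D : ℕ) (h : ℕ → ℕ) (k : ℕ)
    (f : ℕ → ℕ) : ℕ :=
  max
    (mu c C l L D h (16 * c ^ 2 * (k + 1) ^ 2 - 1)
      (fun m => f (max m (l (4 * c * D * (k + 1) - 1))) + 1))
    (l (4 * c * D * (k + 1) - 1))

/-- `Θ[L, E, d₀, d₁, d₂](k)` -/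
noncomputable def Theta (L E : ℕ → ℕ) (d0 d1 d2 k : ℕ) : ℕ :=
  L (E (3 * k + 2) +
    ⌈Real.log (3 * ((max (2 * d0 + d1) d2 : ℕ) : ℝ) * ((k : ℝ) + 1))⌉₊) + 1

/-- `ν̃(k, f) = max {μ̃(2k+1, f̆), Θ(4k+3)}` with `f̆(m) = f(max {m, Θ(4k+3)})` -/
noncomputable def nuTilde (c : ℕ) (C l L : ℕ → ℕ) (D : ℕ) (h E : ℕ → ℕ) (d0 d1 d2 : ℕ)
    (k : ℕ) (f : ℕ → ℕ) : ℕ :=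
  max
    (muTilde c C l L D h (2 * k + 1) (fun m => f (max m (Theta L E d0 d1 d2 (4 * k + 3)))))
    (Theta L E d0 d1 d2 (4 * k + 3))

end Bounds

end MPPA

/-! The errors are removed first. Resolvents are nonexpansive, so `‖z n - y n‖` contracts by `1 -
lam n` up to `‖e n‖`, and the divergence of `∑ lam n` makes it small from `Theta` on. It remains to
treat the exact iteration `y`.

Let `x` be an approximate projection of `u` onto the common fixed point set of the resolvents:
almost fixed by `J_{1/c}`, and almost satisfying the variational inequality of the projection
against all sufficiently good approximate fixed points (`exists_approx_projection`). Comparison of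
resolvents with different parameters makes `x` almost fixed by every `J_{c_i}` with `i` in the
relevant finite range. Firm nonexpansiveness then bounds `‖J y_i - y_i‖²` by a multiple of the drop
`‖y_i - x‖² - ‖y_{i+1} - x‖²`, plus terms in `lam i` and in the defect of `x`.

Two cases remain. If `‖y_i - x‖` never increases on a long enough interval, then, being bounded, it
is almost constant on a long subinterval; the drops there are small, and so are the residuals.
Otherwise it increases somewhere, and every later `j` has a last increase `t` before it. At `t` the
drop is negative, so the residual is small and the variational inequality applies to `y_t`. The step
estimate, divided by `lam t`, puts `y_{t+1}` close to `x`; after `t` the distance no longer grows,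
so `y_j` is close to `x` and has a small residual as well (`exists_le_mu`).

The existence of resolvents (Minty's theorem) is proved by minimising a quadratic functional over a
convex hull built from the graph. -/

namespace MPPA

/-! ### Minty's theorem and the geometry of resolvents -/

section Resolvent

variable {H : Type*} [NormedAddCommGroup H] [InnerProductSpace ℝ H]

/-- Points of the convex hull of `{(x, y, ⟪x, y⟫) | (x, y) ∈ G}` lie above the duality pairing when
the graph `G` is monotone. -/
theorem inner_le_of_mem_convexHull {G : Set (H × H)}
    (hG : ∀ a ∈ G, ∀ b ∈ G, 0 ≤ inner ℝ (a.1 - b.1) (a.2 - b.2)) {q : H × H × ℝ}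
    (hq : q ∈ convexHull ℝ ((fun a : H × H => (a.1, a.2, inner ℝ a.1 a.2)) '' G)) :
    inner ℝ q.1 q.2.1 ≤ q.2.2 := by
  have half : ∀ (a b : H) (r : ℝ),
      Convex ℝ {w : H × H × ℝ | 0 ≤ r + w.2.2 - inner ℝ w.1 b - inner ℝ a w.2.1} := by
    intro a b r v hv w hw s t hs ht hst
    simp only [Set.mem_ofPred_eq, Prod.fst_add, Prod.snd_add, Prod.smul_fst, Prod.smul_snd,
      inner_add_left, inner_add_right, real_inner_smul_left, real_inner_smul_right,
      smul_eq_mul] at hv hw ⊢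
    have hr : r = s * r + t * r := by rw [← add_mul, hst, one_mul]
    have := mul_nonneg hs hv
    have := mul_nonneg ht hw
    linarith
  have h1 : ∀ a ∈ G, 0 ≤ inner ℝ a.1 a.2 + q.2.2 - inner ℝ q.1 a.2 - inner ℝ a.1 q.2.1 := by
    intro a ha
    refine convexHull_min ?_ (half a.1 a.2 (inner ℝ a.1 a.2)) hq
    rintro _ ⟨b, hb, rfl⟩
    have := hG a ha b hb
    simp only [inner_sub_left, inner_sub_right] at this
    simp only [Set.mem_ofPred_eq]
    linarith
  -- By `h1` the half-space attached to `q` itself contains all generators, hence also `q`; this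
  -- says `2 * ⟪q.1, q.2.1⟫ ≤ 2 * q.2.2`.
  have h2 : q ∈ {w : H × H × ℝ | 0 ≤ q.2.2 + w.2.2 - inner ℝ w.1 q.2.1 - inner ℝ q.1 w.2.1} := by
    refine convexHull_min ?_ (half q.1 q.2.1 q.2.2) hq
    rintro _ ⟨b, hb, rfl⟩
    have := h1 b hb
    simp only [Set.mem_ofPred_eq]
    linarith
  simp only [Set.mem_ofPred_eq] at h2
  linarith

/-- A convex set of `H × ℝ` on which `‖v‖² / 4 + α` is nonnegative admits a supporting point. -/
theorem exists_supporting_point [CompleteSpace H] {K : Set (H × ℝ)} (hK : Convex ℝ K)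
    (hne : K.Nonempty) (hpos : ∀ q ∈ K, 0 ≤ ‖q.1‖ ^ 2 / 4 + q.2) :
    ∃ x : H, ∀ q ∈ K, 0 ≤ q.2 + inner ℝ x q.1 - ‖x‖ ^ 2 := by
  set F : H × ℝ → ℝ := fun q => ‖q.1‖ ^ 2 / 4 + q.2 with hF
  set m : ℝ := sInf (F '' K) with hm
  have hbdd : BddBelow (F '' K) := ⟨0, by rintro _ ⟨q, hq, rfl⟩; exact hpos q hq⟩
  have hle : ∀ q ∈ K, m ≤ F q := fun q hq => csInf_le hbdd ⟨q, hq, rfl⟩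
  have hm0 : 0 ≤ m := le_csInf (hne.image F) (by rintro _ ⟨q, hq, rfl⟩; exact hpos q hq)
  have hex : ∀ n : ℕ, ∃ q ∈ K, F q < m + 1 / ((n : ℝ) + 1) := by
    intro n
    obtain ⟨_, ⟨q, hq, rfl⟩, h⟩ := exists_lt_of_csInf_lt (hne.image F)
      (lt_add_of_pos_right m (Nat.one_div_pos_of_nat (n := n) (α := ℝ)))
    exact ⟨q, hq, h⟩
  choose q hqK hq using hex
  -- Strong convexity of `F` in the first component. At `t = 1/2` it makes the first components of a
  -- minimising sequence Cauchy; as `t → 0` it yields the optimality condition at their limit `v`.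
  -- Neither closedness of `K` nor convergence of the second components is needed.
  have key : ∀ a ∈ K, ∀ b ∈ K, ∀ t : ℝ, 0 ≤ t → t ≤ 1 →
      m ≤ (1 - t) * F a + t * F b - t * (1 - t) * ‖a.1 - b.1‖ ^ 2 / 4 := by
    intro a ha b hb t ht0 ht1
    have h := hle _ (hK ha hb (sub_nonneg.2 ht1) ht0 (by ring))
    simp only [hF, Prod.fst_add, Prod.snd_add, Prod.smul_fst, Prod.smul_snd, smul_eq_mul] at h ⊢
    have e1 : ‖(1 - t) • a.1 + t • b.1‖ ^ 2 =
        (1 - t) * ‖a.1‖ ^ 2 + t * ‖b.1‖ ^ 2 - t * (1 - t) * ‖a.1 - b.1‖ ^ 2 := by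
      rw [norm_add_sq_real, norm_sub_sq_real, norm_smul, norm_smul, real_inner_smul_left,
        real_inner_smul_right, mul_pow, mul_pow, Real.norm_eq_abs, Real.norm_eq_abs, sq_abs,
        sq_abs]
      ring
    rw [e1] at h
    linarith
  have hlim : Filter.Tendsto (fun n : ℕ => 1 / ((n : ℝ) + 1)) Filter.atTop (nhds 0) :=
    tendsto_one_div_add_atTop_nhds_zero_nat
  have hcau : CauchySeq fun n => (q n).1 := by
    have hdist : ∀ n k N : ℕ, N ≤ n → N ≤ k →
        dist (q n).1 (q k).1 ≤ Real.sqrt (16 * (1 / ((N : ℝ) + 1))) := by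
      intro n k N hn hk
      rw [dist_eq_norm]
      apply Real.le_sqrt_of_sq_le
      have h := key _ (hqK n) _ (hqK k) (1 / 2) (by norm_num) (by norm_num)
      have h1 := hq n
      have h2 := hq k
      have h3 : 1 / ((n : ℝ) + 1) ≤ 1 / ((N : ℝ) + 1) := Nat.one_div_le_one_div hn
      have h4 : 1 / ((k : ℝ) + 1) ≤ 1 / ((N : ℝ) + 1) := Nat.one_div_le_one_div hk
      linarith
    refine cauchySeq_of_le_tendsto_0 _ hdist ?_
    have := (hlim.const_mul 16).sqrt
    simpa using this
  obtain ⟨v, hv⟩ := cauchySeq_tendsto_of_complete hcau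
  have hFlim : Filter.Tendsto (fun n => F (q n)) Filter.atTop (nhds m) := by
    refine tendsto_of_tendsto_of_tendsto_of_le_of_le tendsto_const_nhds
      (by simpa using hlim.const_add m) (fun n => hle _ (hqK n)) (fun n => (hq n).le)
  -- The gradient of `‖·‖² / 4` at `v` is `v / 2`.
  refine ⟨(1 / 2 : ℝ) • v, fun b hb => ?_⟩
  have h1 : ∀ t : ℝ, 0 < t → t ≤ 1 → m ≤ F b - (1 - t) * ‖v - b.1‖ ^ 2 / 4 := by
    intro t ht0 ht1
    have h2 : m ≤ (1 - t) * m + t * F b - t * (1 - t) * ‖v - b.1‖ ^ 2 / 4 := by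
      refine ge_of_tendsto' (x := Filter.atTop)
        (f := fun n => (1 - t) * F (q n) + t * F b - t * (1 - t) * ‖(q n).1 - b.1‖ ^ 2 / 4) ?_
        (fun n => key _ (hqK n) b hb t ht0.le ht1)
      exact ((hFlim.const_mul _).add_const _).sub
        ((((hv.sub_const _).norm.pow 2).const_mul _).div_const _)
    have h3 : 0 ≤ t * (F b - (1 - t) * ‖v - b.1‖ ^ 2 / 4 - m) := by linarith
    have := nonneg_of_mul_nonneg_right h3 ht0
    linarith
  have h4 : m ≤ F b - (1 - 0) * ‖v - b.1‖ ^ 2 / 4 := by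
    have hc : Filter.Tendsto (fun t : ℝ => F b - (1 - t) * ‖v - b.1‖ ^ 2 / 4)
        (nhdsWithin 0 (Set.Ioi 0)) (nhds (F b - (1 - 0) * ‖v - b.1‖ ^ 2 / 4)) :=
      (Continuous.tendsto (by fun_prop) 0).mono_left nhdsWithin_le_nhds
    refine ge_of_tendsto hc ?_
    filter_upwards [Ioc_mem_nhdsGT (zero_lt_one (α := ℝ))] with t ht
    exact h1 t ht.1 ht.2
  simp only [hF] at h4
  rw [norm_sub_sq_real] at h4
  rw [real_inner_smul_left, norm_smul, mul_pow, Real.norm_eq_abs, sq_abs]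
  linarith

/-- Minty's theorem: the resolvent of a maximal monotone operator is everywhere defined. -/
theorem resolventSet_nonempty [CompleteSpace H] {A : H → Set H} (hA : IsMaximalMonotoneOp A)
    (hne : ∃ a, (A a).Nonempty) {σ : ℝ} (hσ : 0 < σ) (w : H) : (resolventSet A σ w).Nonempty := by
  set G : Set (H × H) := {a | ∃ v ∈ A a.1, a.2 = σ • v - w} with hG
  have hGm : ∀ a ∈ G, ∀ b ∈ G, 0 ≤ inner ℝ (a.1 - b.1) (a.2 - b.2) := by
    rintro ⟨a, _⟩ ⟨v, hv, rfl⟩ ⟨b, _⟩ ⟨v', hv', rfl⟩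
    have := hA.1 a v b v' hv hv'
    simp only [sub_sub_sub_cancel_right, ← smul_sub, real_inner_smul_right]
    exact mul_nonneg hσ.le this
  set g : H × H → H × H × ℝ := fun a => (a.1, a.2, inner ℝ a.1 a.2) with hg
  -- With `T (a, b, α) = (a - b, α)`, the hull inequality `⟪a, b⟫ ≤ α` gives `‖a - b‖² / 4 + α ≥ ‖a
  -- + b‖² / 4 ≥ 0`. The supporting point `x` then satisfies `⟪a - x, b + x⟫ ≥ 0` on `G`, so the
  -- pair `(x, σ⁻¹ (w - x))` is monotonically related to the graph of `A` and belongs to it by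
  -- maximality.
  set T : (H × H × ℝ) →ₗ[ℝ] H × ℝ :=
    (LinearMap.fst ℝ H (H × ℝ) - (LinearMap.fst ℝ H ℝ).comp (LinearMap.snd ℝ H (H × ℝ))).prod
      ((LinearMap.snd ℝ H ℝ).comp (LinearMap.snd ℝ H (H × ℝ))) with hT
  have hTq : ∀ q, T q = (q.1 - q.2.1, q.2.2) := fun q => rfl
  obtain ⟨x, hx⟩ := exists_supporting_point (K := T '' convexHull ℝ (g '' G))
    ((convex_convexHull ℝ _).linear_image T)
    (by
      obtain ⟨a, v, hv⟩ := hne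
      exact ⟨_, _, subset_convexHull ℝ _ ⟨(a, σ • v - w), ⟨v, hv, rfl⟩, rfl⟩, rfl⟩)
    (by
      rintro _ ⟨q, hq, rfl⟩
      have h := inner_le_of_mem_convexHull hGm hq
      have h2 := norm_add_sq_real q.1 q.2.1
      have h3 := norm_sub_sq_real q.1 q.2.1
      have h4 := sq_nonneg ‖q.1 + q.2.1‖
      rw [hTq]
      dsimp only
      linarith)
  have key : ∀ a v, v ∈ A a → 0 ≤ inner ℝ (a - x) (v - σ⁻¹ • (w - x)) := by
    intro a v hv
    have h := hx (T (g (a, σ • v - w)))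
      ⟨_, subset_convexHull ℝ _ ⟨(a, σ • v - w), ⟨v, hv, rfl⟩, rfl⟩, rfl⟩
    rw [hTq] at h
    have h1 : inner ℝ (a - x) (v - σ⁻¹ • (w - x)) =
        σ⁻¹ * inner ℝ (a - x) (σ • v - (w - x)) := by
      rw [← real_inner_smul_right, smul_sub σ⁻¹ (σ • v), smul_smul, inv_mul_cancel₀ hσ.ne',
        one_smul]
    rw [h1]
    refine mul_nonneg (inv_nonneg.2 hσ.le) ?_
    refine h.trans_eq ?_
    simp only [hg, inner_sub_left, inner_sub_right, real_inner_smul_right,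
      ← real_inner_self_eq_norm_sq, real_inner_comm x]
    ring
  have hB := hA.2 (fun a => {v | v ∈ A a ∨ (a = x ∧ v = σ⁻¹ • (w - x))})
    (by
      rintro a v b v' (hv | ⟨rfl, rfl⟩) (hv' | ⟨rfl, rfl⟩)
      · exact hA.1 a v b v' hv hv'
      · exact key a v hv
      · rw [← neg_sub b, ← neg_sub v', inner_neg_neg]
        exact key b v' hv'
      · simp)
    (fun a v hv => Or.inl hv)
  refine ⟨x, σ⁻¹ • (w - x), ?_, ?_⟩
  · rw [← hB]
    exact Or.inr ⟨rfl, rfl⟩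
  · rw [smul_smul, mul_inv_cancel₀ hσ.ne', one_smul, add_sub_cancel]

variable [CompleteSpace H] {A : H → Set H}

theorem resolvent_mem (hA : IsMaximalMonotoneOp A) (hne : ∃ a, (A a).Nonempty) {σ : ℝ}
    (hσ : 0 < σ) (x : H) : resolvent A σ x ∈ resolventSet A σ x :=
  Classical.epsilon_spec (resolventSet_nonempty hA hne hσ x)

theorem exists_resolvent_add_smul (hA : IsMaximalMonotoneOp A) (hne : ∃ a, (A a).Nonempty)
    {σ : ℝ} (hσ : 0 < σ) (x : H) : σ⁻¹ • (x - resolvent A σ x) ∈ A (resolvent A σ x) := by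
  obtain ⟨v, hv, h⟩ := resolvent_mem hA hne hσ x
  rw [← eq_sub_iff_add_eq'] at h
  rwa [← h, smul_smul, inv_mul_cancel₀ hσ.ne', one_smul]

theorem resolvent_eq_self (hA : IsMaximalMonotoneOp A) {p : H} (hp : p ∈ zeros A) {σ : ℝ}
    (hσ : 0 < σ) : resolvent A σ p = p :=
  resolventSet_subsingleton hA.1 hσ p (resolvent_mem hA ⟨p, 0, hp⟩ hσ p)
    ⟨0, hp, by rw [smul_zero, add_zero]⟩

/-- The resolvent is firmly nonexpansive. -/
theorem norm_resolvent_sub_sq_le (hA : IsMaximalMonotoneOp A) (hne : ∃ a, (A a).Nonempty)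
    {σ : ℝ} (hσ : 0 < σ) (x y : H) :
    ‖resolvent A σ x - resolvent A σ y‖ ^ 2 ≤
      ‖x - y‖ ^ 2 - ‖(x - resolvent A σ x) - (y - resolvent A σ y)‖ ^ 2 := by
  have h := hA.1 _ _ _ _ (exists_resolvent_add_smul hA hne hσ x)
    (exists_resolvent_add_smul hA hne hσ y)
  rw [← smul_sub, real_inner_smul_right] at h
  have h1 := nonneg_of_mul_nonneg_right h (inv_pos.2 hσ)
  have h2 : x - y = (resolvent A σ x - resolvent A σ y) +
      ((x - resolvent A σ x) - (y - resolvent A σ y)) := by abel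
  have h3 := norm_add_sq_real (resolvent A σ x - resolvent A σ y)
    ((x - resolvent A σ x) - (y - resolvent A σ y))
  rw [← h2] at h3
  linarith

theorem norm_resolvent_sub_le (hA : IsMaximalMonotoneOp A) (hne : ∃ a, (A a).Nonempty)
    {σ : ℝ} (hσ : 0 < σ) (x y : H) :
    ‖resolvent A σ x - resolvent A σ y‖ ≤ ‖x - y‖ := by
  have h := norm_resolvent_sub_sq_le hA hne hσ x y
  exact (sq_le_sq₀ (norm_nonneg _) (norm_nonneg _)).1 (h.trans (sub_le_self _ (sq_nonneg _)))

theorem norm_resolvent_sub_zero_le (hA : IsMaximalMonotoneOp A) {p : H} (hp : p ∈ zeros A)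
    {σ : ℝ} (hσ : 0 < σ) (x : H) : ‖resolvent A σ x - p‖ ≤ ‖x - p‖ := by
  simpa only [resolvent_eq_self hA hp hσ] using norm_resolvent_sub_le hA ⟨p, 0, hp⟩ hσ x p

theorem norm_resolvent_sub_self_le (hA : IsMaximalMonotoneOp A) {p : H} (hp : p ∈ zeros A)
    {σ : ℝ} (hσ : 0 < σ) (x : H) : ‖resolvent A σ x - x‖ ≤ ‖x - p‖ := by
  have h := norm_resolvent_sub_sq_le hA ⟨p, 0, hp⟩ hσ x p
  rw [resolvent_eq_self hA hp hσ, sub_self, sub_zero, norm_sub_rev x (resolvent A σ x)] at h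
  have := sq_nonneg ‖resolvent A σ x - p‖
  exact (sq_le_sq₀ (norm_nonneg _) (norm_nonneg _)).1 (by linarith)

/-- Monotonicity of `A` between the points `J_r x` and `J_s x`, followed by Cauchy–Schwarz, produces
this factored form. The signs of the two factors give both comparisons of residuals for `r ≤ s`: the
residual grows with the parameter, and by at most the factor `s / r`. -/
theorem resolvent_residual_mul_nonpos (hA : IsMaximalMonotoneOp A) (hne : ∃ a, (A a).Nonempty)
    {r s : ℝ} (hr : 0 < r) (hs : 0 < s) (x : H) :
    (s * ‖resolvent A r x - x‖ - r * ‖resolvent A s x - x‖) *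
      (‖resolvent A r x - x‖ - ‖resolvent A s x - x‖) ≤ 0 := by
  have h := hA.1 _ _ _ _ (exists_resolvent_add_smul hA hne hr x)
    (exists_resolvent_add_smul hA hne hs x)
  rw [norm_sub_rev _ x, norm_sub_rev _ x]
  set a := x - resolvent A r x with ha
  set b := x - resolvent A s x with hb
  have e : resolvent A r x - resolvent A s x = b - a := by rw [ha, hb]; abel
  rw [e] at h
  have h1 : r * s * inner ℝ (b - a) (r⁻¹ • a - s⁻¹ • b) =
      s * inner ℝ a b - s * ‖a‖ ^ 2 - r * ‖b‖ ^ 2 + r * inner ℝ a b := by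
    simp only [inner_sub_left, inner_sub_right, real_inner_smul_right,
      real_inner_self_eq_norm_sq, real_inner_comm a b]
    field_simp
    ring
  have h2 := mul_nonneg (mul_pos hr hs).le h
  rw [h1] at h2
  have h3 := real_inner_le_norm a b
  have h4 : (s + r) * inner ℝ a b ≤ (s + r) * (‖a‖ * ‖b‖) :=
    mul_le_mul_of_nonneg_left h3 (add_pos hs hr).le
  linarith

theorem norm_resolvent_sub_self_mono (hA : IsMaximalMonotoneOp A) (hne : ∃ a, (A a).Nonempty)
    {r s : ℝ} (hr : 0 < r) (hrs : r ≤ s) (x : H) :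
    ‖resolvent A r x - x‖ ≤ ‖resolvent A s x - x‖ := by
  by_contra! hlt
  have h := resolvent_residual_mul_nonpos hA hne hr (hr.trans_le hrs) x
  have h1 : r * ‖resolvent A s x - x‖ < s * ‖resolvent A r x - x‖ :=
    calc r * ‖resolvent A s x - x‖ ≤ s * ‖resolvent A s x - x‖ :=
          mul_le_mul_of_nonneg_right hrs (norm_nonneg _)
      _ < s * ‖resolvent A r x - x‖ := mul_lt_mul_of_pos_left hlt (hr.trans_le hrs)
  exact absurd h (not_le.2 (mul_pos (sub_pos.2 h1) (sub_pos.2 hlt)))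

theorem mul_norm_resolvent_sub_self_le (hA : IsMaximalMonotoneOp A) (hne : ∃ a, (A a).Nonempty)
    {r s : ℝ} (hr : 0 < r) (hrs : r ≤ s) (x : H) :
    r * ‖resolvent A s x - x‖ ≤ s * ‖resolvent A r x - x‖ := by
  by_contra! hlt
  have h := resolvent_residual_mul_nonpos hA hne hr (hr.trans_le hrs) x
  rcases (norm_resolvent_sub_self_mono hA hne hr hrs x).eq_or_lt with h1 | h1
  · rw [h1] at hlt
    exact absurd hlt (not_lt.2 (mul_le_mul_of_nonneg_right hrs (norm_nonneg _)))
  · exact absurd h (not_le.2 (mul_pos_of_neg_of_neg (sub_neg.2 hlt) (sub_neg.2 h1)))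

end Resolvent

/-! ### Approximate projection onto the fixed point set -/

section Projection

variable {H : Type*} [NormedAddCommGroup H] [InnerProductSpace ℝ H]

/-- Convex combinations of almost fixed points of a nonexpansive map are almost fixed. -/
theorem norm_map_lineMap_sub_sq_le {T : H → H} (hT : ∀ x y, ‖T x - T y‖ ≤ ‖x - y‖) {x y : H}
    {ε M t : ℝ} (hx : ‖T x - x‖ ≤ ε) (hy : ‖T y - y‖ ≤ ε) (hxy : ‖x - y‖ ≤ M) (ht0 : 0 ≤ t)
    (ht1 : t ≤ 1) :
    ‖T ((1 - t) • x + t • y) - ((1 - t) • x + t • y)‖ ^ 2 ≤ M * ε + ε ^ 2 := by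
  set w := (1 - t) • x + t • y with hw
  have hε : 0 ≤ ε := (norm_nonneg _).trans hx
  have h1t : 0 ≤ 1 - t := sub_nonneg.2 ht1
  have hwx : ‖T w - x‖ ≤ t * ‖x - y‖ + ε := by
    have e : w - x = t • (y - x) := by rw [hw]; module
    have h1 : ‖T w - T x‖ ≤ t * ‖x - y‖ := by
      refine (hT w x).trans_eq ?_
      rw [e, norm_smul, Real.norm_of_nonneg ht0, norm_sub_rev]
    calc ‖T w - x‖ ≤ ‖T w - T x‖ + ‖T x - x‖ := norm_sub_le_norm_sub_add_norm_sub _ _ _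
      _ ≤ _ := add_le_add h1 hx
  have hwy : ‖T w - y‖ ≤ (1 - t) * ‖x - y‖ + ε := by
    have e : w - y = (1 - t) • (x - y) := by rw [hw]; module
    have h1 : ‖T w - T y‖ ≤ (1 - t) * ‖x - y‖ := by
      refine (hT w y).trans_eq ?_
      rw [e, norm_smul, Real.norm_of_nonneg h1t]
    calc ‖T w - y‖ ≤ ‖T w - T y‖ + ‖T y - y‖ := norm_sub_le_norm_sub_add_norm_sub _ _ _
      _ ≤ _ := add_le_add h1 hy
  -- After inserting `hwx` and `hwy`, the terms `t (1 - t) ‖x - y‖²` cancel; what remains is `4 t (1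
  -- - t) ‖x - y‖ ε + ε²`.
  have e1 : ‖T w - w‖ ^ 2 =
      (1 - t) * ‖T w - x‖ ^ 2 + t * ‖T w - y‖ ^ 2 - t * (1 - t) * ‖x - y‖ ^ 2 := by
    have e2 : T w - w = (1 - t) • (T w - x) + t • (T w - y) := by rw [hw]; module
    have e3 : x - y = (T w - y) - (T w - x) := by abel
    rw [e2, e3, norm_add_sq_real, norm_sub_sq_real (T w - y), norm_smul, norm_smul,
      real_inner_smul_left, real_inner_smul_right, mul_pow, mul_pow, Real.norm_eq_abs,
      Real.norm_eq_abs, sq_abs, sq_abs, real_inner_comm (T w - x)]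
    ring
  have h1 : ‖T w - x‖ ^ 2 ≤ (t * ‖x - y‖ + ε) ^ 2 := pow_le_pow_left₀ (norm_nonneg _) hwx 2
  have h2 : ‖T w - y‖ ^ 2 ≤ ((1 - t) * ‖x - y‖ + ε) ^ 2 := pow_le_pow_left₀ (norm_nonneg _) hwy 2
  have h3 := mul_le_mul_of_nonneg_left h1 h1t
  have h4 := mul_le_mul_of_nonneg_left h2 ht0
  have h5 : ‖x - y‖ * ε ≤ M * ε := mul_le_mul_of_nonneg_right hxy hε
  have h6 : 4 * t * (1 - t) * (‖x - y‖ * ε) ≤ 1 * (‖x - y‖ * ε) := by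
    refine mul_le_mul_of_nonneg_right ?_ (mul_nonneg (norm_nonneg _) hε)
    nlinarith [sq_nonneg (2 * t - 1)]
  rw [e1]
  nlinarith

/-- Almost minimisers of the distance to `u` satisfy an approximate variational inequality. -/
theorem inner_le_of_almost_minimal {u x y : H} {ε M t : ℝ} (ht : 0 < t) (hxy : ‖y - x‖ ≤ M)
    (h : ‖u - x‖ ^ 2 ≤ ‖u - ((1 - t) • x + t • y)‖ ^ 2 + ε) :
    inner ℝ (u - x) (y - x) ≤ t * M ^ 2 / 2 + ε / (2 * t) := by
  have e : u - ((1 - t) • x + t • y) = (u - x) - t • (y - x) := by module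
  rw [e, norm_sub_sq_real (u - x), real_inner_smul_right, norm_smul, mul_pow, Real.norm_eq_abs,
    sq_abs] at h
  have h1 : ‖y - x‖ ^ 2 ≤ M ^ 2 := pow_le_pow_left₀ (norm_nonneg _) hxy 2
  have h2 : t ^ 2 * ‖y - x‖ ^ 2 ≤ t ^ 2 * M ^ 2 := mul_le_mul_of_nonneg_left h1 (sq_nonneg t)
  have h3 : 2 * t * inner ℝ (u - x) (y - x) ≤ 2 * t * (t * M ^ 2 / 2 + ε / (2 * t)) := by
    have : 2 * t * (t * M ^ 2 / 2 + ε / (2 * t)) = t ^ 2 * M ^ 2 + ε := by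
      field_simp
    rw [this]
    linarith
  exact le_of_mul_le_mul_left h3 (by positivity)

/-- A sequence of reals whose total increase over `n` steps is at most `B` increases by at most
`B / n` in one of these steps. -/
theorem exists_small_step {a : ℕ → ℝ} {B : ℝ} (i n : ℕ) (hn : 0 < n) (h : a (i + n) - a i ≤ B) :
    ∃ j, i ≤ j ∧ j < i + n ∧ a (j + 1) - a j ≤ B / n := by
  by_contra! hcon
  have hn' : (0 : ℝ) < n := Nat.cast_pos.2 hn
  have key : ∑ j ∈ Finset.range n, (B / n) < ∑ j ∈ Finset.range n, (a (i + (j + 1)) - a (i + j)) :=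
    Finset.sum_lt_sum_of_nonempty (Finset.nonempty_range_iff.2 hn.ne') fun j hj =>
      hcon (i + j) (Nat.le_add_right _ _) (Nat.add_lt_add_left (Finset.mem_range.1 hj) i)
  rw [Finset.sum_range_sub (fun j => a (i + j)), Finset.sum_const, Finset.card_range, nsmul_eq_mul,
    mul_div_cancel₀ _ hn'.ne', add_zero] at key
  linarith

theorem le_wFun (D : ℕ) (hD : D ≠ 0) (g : ℕ → ℕ) (m : ℕ) : m < wFun D g m := by
  have h1 : 1 ≤ D := Nat.one_le_iff_ne_zero.2 hD
  refine lt_of_lt_of_le ?_ (le_max_right _ _)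
  nlinarith

/-- Approximate metric projection of `u` onto the fixed point set of a nonexpansive map. -/
theorem exists_approx_projection {T : H → H} (hT : ∀ x y, ‖T x - T y‖ ≤ ‖x - y‖) {p u : H}
    (hp : T p = p) {D : ℕ} (hD0 : D ≠ 0) (hu : 2 * ‖u - p‖ ≤ D) (k : ℕ) (g : ℕ → ℕ) :
    ∃ n ≤ beta D k g, k ≤ n ∧ ∃ x, ‖x - p‖ ≤ D ∧ ‖T x - x‖ ≤ 1 / ((g n : ℝ) + 1) ∧
      ∀ y, ‖y - p‖ ≤ D → ‖T y - y‖ ≤ 1 / ((n : ℝ) + 1) →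
        inner ℝ (u - x) (y - x) ≤ 1 / ((k : ℝ) + 1) := by
  have hD1 : 1 ≤ D := Nat.one_le_iff_ne_zero.2 hD0
  have hDR : (1 : ℝ) ≤ D := Nat.one_le_cast.2 hD1
  set N : ℕ → ℕ := fun j => (wFun D g)^[j] 0 with hN
  have hNs : ∀ j, N (j + 1) = wFun D g (N j) := fun j => Function.iterate_succ_apply' _ _ _
  have hNmono : StrictMono N := strictMono_nat_of_lt_succ fun j => by
    rw [hNs]; exact le_wFun D hD0 g _
  -- Half of the iteration count in `beta`. The search for a small step runs over `Q ≤ j < 2 * Q`: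
  -- its length yields the accuracy `θ`, and its start forces `k ≤ j`, whence `k ≤ n`.
  set Q : ℕ := 2 * D ^ 4 * (k + 1) ^ 2 with hQ
  have hQpos : 0 < Q := by positivity
  set S : ℕ → Set H := fun j => {x | ‖x - p‖ ≤ D ∧ ‖T x - x‖ ≤ 1 / ((N j : ℝ) + 1)} with hS
  have hpS : ∀ j, p ∈ S j := fun j => by
    refine ⟨by rw [sub_self, norm_zero]; exact Nat.cast_nonneg _, ?_⟩
    rw [hp, sub_self, norm_zero]; positivity
  -- Squared distances from `u` to ever smaller sets of approximate fixed points, all bounded by `‖u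
  -- - p‖² ≤ D² / 4`. Where `a` hardly grows, a near minimiser over `S (j + 1)` is also one over the
  -- larger set `S j`.
  set a : ℕ → ℝ := fun j => sInf ((fun x => ‖u - x‖ ^ 2) '' S j) with ha
  have hbdd : ∀ j, BddBelow ((fun x => ‖u - x‖ ^ 2) '' S j) := fun j =>
    ⟨0, by rintro _ ⟨x, -, rfl⟩; exact sq_nonneg _⟩
  have ha0 : ∀ j, 0 ≤ a j := fun j =>
    le_csInf ⟨_, p, hpS j, rfl⟩ (by rintro _ ⟨x, -, rfl⟩; exact sq_nonneg _)
  have haD : ∀ j, a j ≤ (D : ℝ) ^ 2 / 4 := fun j => by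
    refine (csInf_le (hbdd j) ⟨p, hpS j, rfl⟩).trans ?_
    have := pow_le_pow_left₀ (by positivity) hu 2
    dsimp only
    linarith
  obtain ⟨j, hj1, hj2, hj⟩ := exists_small_step (a := a) (B := (D : ℝ) ^ 2 / 4) Q Q hQpos
    (by linarith [ha0 Q, haD (Q + Q)])
  set θ : ℝ := 1 / (8 * (D : ℝ) ^ 2 * ((k : ℝ) + 1) ^ 2) with hθ
  have hθpos : 0 < θ := by positivity
  have hstep : a (j + 1) - a j ≤ θ := by
    refine hj.trans_eq ?_
    rw [hθ, hQ]
    push_cast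
    field_simp
    norm_num
  obtain ⟨_, ⟨x, hx, rfl⟩, hxa⟩ := exists_lt_of_csInf_lt (s := (fun x => ‖u - x‖ ^ 2) '' S (j + 1))
    ⟨_, p, hpS _, rfl⟩ (lt_add_of_pos_right (a (j + 1)) hθpos)
  set n := 24 * D * (N j + 1) ^ 2 with hn
  have hjn : j ≤ N j := hNmono.le_apply
  have hgn : g n ≤ N (j + 1) := by rw [hNs]; exact le_max_left _ _
  have hnn : n ≤ N (j + 1) := by rw [hNs]; exact le_max_right _ _
  refine ⟨n, ?_, ?_, x, hx.1, ?_, ?_⟩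
  · have : N j ≤ N (4 * D ^ 4 * (k + 1) ^ 2) := hNmono.monotone (by
      have : 4 * D ^ 4 * (k + 1) ^ 2 = Q + Q := by rw [hQ]; ring
      omega)
    unfold beta
    exact Nat.mul_le_mul_left _ (Nat.pow_le_pow_left (Nat.add_le_add_right this 1) 2)
  · have h1 : 1 ≤ D ^ 4 := Nat.one_le_pow _ _ hD1
    have h2 : k ≤ Q := by rw [hQ]; nlinarith
    have h3 : N j ≤ n := by rw [hn]; nlinarith
    omega
  · refine hx.2.trans ?_
    exact Nat.one_div_le_one_div hgn
  · intro y hy hTy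
    have hxy : ‖x - y‖ ≤ 2 * D := by
      have := norm_sub_le (x - p) (y - p)
      rw [sub_sub_sub_cancel_right] at this
      linarith [hx.1]
    -- With `M = 2 * D` and `ε = 2 * θ`, this `t` makes each of the two terms of
    -- `inner_le_of_almost_minimal` equal to `1 / (2 * (k + 1))`.
    set t : ℝ := 1 / (4 * (D : ℝ) ^ 2 * ((k : ℝ) + 1)) with ht
    have ht0 : 0 < t := by positivity
    have ht1 : t ≤ 1 := by
      rw [ht, div_le_one (by positivity)]
      have : (1 : ℝ) ≤ (D : ℝ) ^ 2 := one_le_pow₀ hDR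
      nlinarith [(Nat.cast_nonneg k : (0 : ℝ) ≤ k)]
    have hw : (1 - t) • x + t • y ∈ S j := by
      refine ⟨?_, ?_⟩
      · have e : (1 - t) • x + t • y - p = (1 - t) • (x - p) + t • (y - p) := by module
        rw [e]
        refine (norm_add_le _ _).trans ?_
        rw [norm_smul, norm_smul, Real.norm_of_nonneg ht0.le,
          Real.norm_of_nonneg (sub_nonneg.2 ht1)]
        nlinarith [mul_le_mul_of_nonneg_left hx.1 (sub_nonneg.2 ht1),
          mul_le_mul_of_nonneg_left hy ht0.le]
      · have h := norm_map_lineMap_sub_sq_le hT (hx.2.trans (Nat.one_div_le_one_div hnn)) hTy hxy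
          ht0.le ht1
        refine abs_le_of_sq_le_sq' (h.trans ?_) (by positivity) |>.2
        have hNp : (0 : ℝ) < (N j : ℝ) + 1 := by positivity
        have e : (1 / ((N j : ℝ) + 1)) ^ 2 = 24 * D * (1 / (24 * D * ((N j : ℝ) + 1) ^ 2)) := by
          field_simp
        have hnp : (0 : ℝ) < 24 * D * ((N j : ℝ) + 1) ^ 2 := by positivity
        have h1 : 1 / ((n : ℝ) + 1) ≤ 1 / (24 * D * ((N j : ℝ) + 1) ^ 2) := by
          refine one_div_le_one_div_of_le hnp ?_
          rw [hn]; push_cast; linarith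
        have h2 : 1 / ((n : ℝ) + 1) ≤ 1 := by
          rw [div_le_one (by positivity)]; linarith [(Nat.cast_nonneg n : (0 : ℝ) ≤ n)]
        have h3 : 0 ≤ 1 / ((n : ℝ) + 1) := by positivity
        rw [e]
        nlinarith
    have hmin : ‖u - x‖ ^ 2 ≤ ‖u - ((1 - t) • x + t • y)‖ ^ 2 + 2 * θ := by
      have := csInf_le (hbdd j) ⟨_, hw, rfl⟩
      dsimp only at this hxa
      linarith
    rw [norm_sub_rev] at hxy
    refine (inner_le_of_almost_minimal ht0 hxy hmin).trans_eq ?_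
    rw [hθ, ht]
    field_simp
    norm_num

end Projection

/-! ### Real sequences: almost constant stretches and last increases -/

section Sequences

/-- A bounded sequence that is nonincreasing along the iterates of `g` has almost no drop on one of
the intervals `[N, g N]`. -/
theorem exists_almost_constant {s : ℕ → ℝ} {D r m : ℕ} (hD : D ≠ 0) {g : ℕ → ℕ} (hg : Monotone g)
    (hm : m ≤ g m) (hs0 : ∀ i, 0 ≤ s i) (hsD : ∀ i, s i ≤ 4 * (D : ℝ) ^ 2)
    (hanti : ∀ i, m ≤ i → i < g^[4 * D ^ 2 * (r + 1)] m → s (i + 1) ≤ s i) :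
    ∃ N, m ≤ N ∧ N ≤ g^[4 * D ^ 2 * (r + 1)] m ∧
      ∀ i, N ≤ i → i + 1 ≤ g N → s i - s (i + 1) ≤ 1 / ((r : ℝ) + 1) := by
  set R := 4 * D ^ 2 * (r + 1) with hR
  have hRpos : 0 < R := by positivity
  have hmono : Monotone fun n => g^[n] m := hg.monotone_iterate_of_le_map hm
  -- `R` blocks share a total drop of at most `4 * D ^ 2`, so one of them drops by at most `4 * D ^
  -- 2 / R = 1 / (r + 1)`; the sign turns drops into increases.
  obtain ⟨j, -, hjR, hj⟩ := exists_small_step (a := fun j => -s (g^[j] m)) (B := 4 * (D : ℝ) ^ 2)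
    0 R hRpos (by linarith [hs0 (g^[0 + R] m), hsD (g^[0] m)])
  rw [zero_add] at hjR
  have hle : ∀ a b, m ≤ a → a ≤ b → b ≤ g^[R] m → s b ≤ s a := by
    intro a b hma hab
    induction b, hab using Nat.le_induction with
    | base => exact fun _ => le_rfl
    | succ b hab ih => exact fun hb => (hanti b (hma.trans hab) hb).trans (ih (Nat.le_of_lt hb))
  have hmj : m ≤ g^[j] m := hmono (Nat.zero_le j)
  have hjR' : g^[j + 1] m ≤ g^[R] m := hmono hjR
  refine ⟨g^[j] m, hmj, hmono hjR.le, fun i hi hi' => ?_⟩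
  rw [← Function.iterate_succ_apply' g] at hi'
  have h1 := hle _ i hmj hi ((Nat.le_of_lt hi').trans hjR')
  have h2 := hle (i + 1) _ ((hmj.trans hi).trans i.le_succ) hi' hjR'
  have h3 : 4 * (D : ℝ) ^ 2 / (R : ℝ) = 1 / ((r : ℝ) + 1) := by
    rw [hR]; push_cast; field_simp
  rw [h3] at hj
  linarith

/-- Taking the last increase before `m` ensures that `s` does not rise between `t + 1` and `m`, so a
bound just after the increase carries over to `m`. -/
theorem exists_last_increase {s : ℕ → ℝ} {i m : ℕ} (him : i < m) (hi : s i < s (i + 1)) :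
    ∃ t, i ≤ t ∧ t < m ∧ s t < s (t + 1) ∧ s m ≤ s (t + 1) := by
  induction m, (Nat.succ_le_of_lt him) using Nat.le_induction with
  | base => exact ⟨i, le_rfl, i.lt_succ_self, hi, le_rfl⟩
  | succ m hm ih =>
    rcases lt_or_ge (s m) (s (m + 1)) with h | h
    · exact ⟨m, Nat.le_of_succ_le hm, m.lt_succ_self, h, le_rfl⟩
    · obtain ⟨t, h1, h2, h3, h4⟩ := ih hm
      exact ⟨t, h1, h2.trans m.lt_succ_self, h3, h.trans h4⟩

theorem cast_sub_one_add_one {m : ℕ} (hm : m ≠ 0) : ((m - 1 : ℕ) : ℝ) + 1 = m := by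
  exact_mod_cast Nat.sub_add_cancel (Nat.one_le_iff_ne_zero.2 hm)

theorem le_of_le_sum {lam : ℕ → ℝ} (hlam : ∀ n, lam n ≤ 1) {L : ℕ → ℕ}
    (hL : ∀ k : ℕ, (k : ℝ) ≤ ∑ i ∈ Finset.Icc 1 (L k), lam i) (k : ℕ) : k ≤ L k := by
  have h : ∑ i ∈ Finset.Icc 1 (L k), lam i ≤ ∑ i ∈ Finset.Icc 1 (L k), (1 : ℝ) :=
    Finset.sum_le_sum fun i _ => hlam i
  rw [Finset.sum_const, Nat.card_Icc, nsmul_eq_mul, mul_one, Nat.add_sub_cancel] at h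
  exact_mod_cast (hL k).trans h

theorem norm_sub_le_two_mul {H : Type*} [NormedAddCommGroup H] {p x y : H} {D : ℝ} (hx : ‖x - p‖ ≤ D) (hy : ‖y - p‖ ≤ D) :
    ‖y - x‖ ≤ 2 * D := by
  have := norm_sub_le (y - p) (x - p)
  rw [sub_sub_sub_cancel_right] at this
  linarith

theorem norm_step_sub_le {H : Type*} [NormedAddCommGroup H] [NormedSpace ℝ H] {u y y' J : H} {l g d : ℝ} (hl : 0 ≤ l) (hd : 0 ≤ d)
    (hsum : l + g + d = 1) (hy' : y' = l • u + g • y + d • J) :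
    ‖y' - y‖ ≤ l * ‖u - y‖ + d * ‖J - y‖ := by
  have e : y' - y = l • (u - y) + d • (J - y) := by
    rw [hy']
    have hg : g = 1 - l - d := by linarith
    rw [hg]
    module
  rw [e]
  refine (norm_add_le _ _).trans_eq ?_
  rw [norm_smul, norm_smul, Real.norm_of_nonneg hl, Real.norm_of_nonneg hd]

end Sequences

/-! ### Estimates for one step of the exact iteration -/

section Step

variable {H : Type*} [NormedAddCommGroup H] [InnerProductSpace ℝ H] [CompleteSpace H]
  {A : H → Set H}

/-- Convexity of the squared norm combined with firm nonexpansiveness. That `x` is fixed only up to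
`η` costs `4 D η` (from `‖Jy - Jx‖ ≤ 2 D`), `2 D η` (from `‖Jy - y‖ ≤ D`) and `η² ≤ η`. -/
theorem del_mul_norm_resolvent_sub_sq_le (hA : IsMaximalMonotoneOp A) {p : H} (hp : p ∈ zeros A)
    {σ : ℝ} (hσ : 0 < σ) {u x y y' : H} {l g d η D : ℝ} (hl : 0 ≤ l) (hg : 0 ≤ g) (hd : 0 ≤ d)
    (hsum : l + g + d = 1) (hη1 : η ≤ 1) (hx : ‖resolvent A σ x - x‖ ≤ η)
    (hxD : ‖x - p‖ ≤ D) (hyD : ‖y - p‖ ≤ D)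
    (hy' : y' = l • u + g • y + d • resolvent A σ y) :
    d * ‖resolvent A σ y - y‖ ^ 2 ≤
      ‖y - x‖ ^ 2 - ‖y' - x‖ ^ 2 + l * ‖u - x‖ ^ 2 + η * (6 * D + 1) := by
  have hη : 0 ≤ η := (norm_nonneg _).trans hx
  have hD : 0 ≤ D := (norm_nonneg _).trans hxD
  have hyx := norm_sub_le_two_mul hxD hyD
  set Jy := resolvent A σ y with hJy
  set Jx := resolvent A σ x with hJx
  have hconv : ‖y' - x‖ ^ 2 ≤ l * ‖u - x‖ ^ 2 + g * ‖y - x‖ ^ 2 + d * ‖Jy - x‖ ^ 2 := by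
    have e : y' - x = l • (u - x) + g • (y - x) + d • (Jy - x) := by
      rw [hy']
      have hx1 : x = (l + g + d) • x := by rw [hsum, one_smul]
      nth_rewrite 1 [hx1]
      module
    have h1 : ‖y' - x‖ ≤ l * ‖u - x‖ + g * ‖y - x‖ + d * ‖Jy - x‖ := by
      rw [e]
      refine (norm_add₃_le).trans_eq ?_
      rw [norm_smul, norm_smul, norm_smul, Real.norm_of_nonneg hl, Real.norm_of_nonneg hg,
        Real.norm_of_nonneg hd]
    refine (pow_le_pow_left₀ (norm_nonneg _) h1 2).trans ?_
    have hd' : d = 1 - l - g := by linarith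
    have h2 := mul_nonneg (mul_nonneg hl hg) (sq_nonneg (‖u - x‖ - ‖y - x‖))
    have h3 := mul_nonneg (mul_nonneg hl hd) (sq_nonneg (‖u - x‖ - ‖Jy - x‖))
    have h4 := mul_nonneg (mul_nonneg hg hd) (sq_nonneg (‖y - x‖ - ‖Jy - x‖))
    subst hd'
    nlinarith
  have hfirm := norm_resolvent_sub_sq_le hA ⟨p, 0, hp⟩ hσ y x
  have hne := norm_resolvent_sub_le hA ⟨p, 0, hp⟩ hσ y x
  have hres : ‖Jy - y‖ ≤ D := (norm_resolvent_sub_self_le hA hp hσ y).trans hyD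
  rw [← hJy, ← hJx] at hfirm hne
  have h1 : ‖Jy - x‖ ≤ ‖Jy - Jx‖ + η :=
    (norm_sub_le_norm_sub_add_norm_sub _ Jx _).trans (by gcongr)
  have h2 : ‖Jy - x‖ ^ 2 ≤ (‖Jy - Jx‖ + η) ^ 2 := pow_le_pow_left₀ (norm_nonneg _) h1 2
  have h3 : ‖Jy - y‖ ^ 2 - 2 * (η * D) ≤ ‖(y - Jy) - (x - Jx)‖ ^ 2 := by
    rw [norm_sub_sq_real (y - Jy), norm_sub_rev y Jy]
    have h5 := real_inner_le_norm (y - Jy) (x - Jx)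
    rw [norm_sub_rev y Jy, norm_sub_rev x Jx] at h5
    have h6 : ‖Jy - y‖ * ‖Jx - x‖ ≤ D * η := mul_le_mul hres hx (norm_nonneg _) hD
    have := sq_nonneg ‖x - Jx‖
    linarith
  have h4 : η * ‖Jy - Jx‖ ≤ η * (2 * D) := mul_le_mul_of_nonneg_left (hne.trans hyx) hη
  have h5 : η * η ≤ η * 1 := mul_le_mul_of_nonneg_left hη1 hη
  have h6 : ‖Jy - x‖ ^ 2 ≤ ‖y - x‖ ^ 2 - ‖Jy - y‖ ^ 2 + η * (6 * D + 1) := by nlinarith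
  have h7 := mul_le_mul_of_nonneg_left h6 hd
  have h8 : d * (η * (6 * D + 1)) ≤ 1 * (η * (6 * D + 1)) :=
    mul_le_mul_of_nonneg_right (by linarith) (by positivity)
  have h9 : (g + d) * ‖y - x‖ ^ 2 ≤ 1 * ‖y - x‖ ^ 2 :=
    mul_le_mul_of_nonneg_right (by linarith) (sq_nonneg _)
  linarith

/-- The Halpern inequality `‖v‖² ≤ ‖v - w‖² + 2 ⟪w, v⟫` with `v = y' - x` and `w = l • (u - x)`: it
isolates the inner product that the variational inequality controls. -/
theorem norm_step_sub_sq_le (hA : IsMaximalMonotoneOp A) {p : H} (hp : p ∈ zeros A)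
    {σ : ℝ} (hσ : 0 < σ) {u x y y' : H} {l g d η D : ℝ} (hl : 0 ≤ l) (hg : 0 ≤ g) (hd : 0 ≤ d)
    (hsum : l + g + d = 1) (hη1 : η ≤ 1) (hx : ‖resolvent A σ x - x‖ ≤ η)
    (hxD : ‖x - p‖ ≤ D) (hyD : ‖y - p‖ ≤ D)
    (hy' : y' = l • u + g • y + d • resolvent A σ y) :
    ‖y' - x‖ ^ 2 ≤
      (1 - l) * ‖y - x‖ ^ 2 + 2 * l * inner ℝ (u - x) (y' - x) + η * (4 * D + 1) := by
  have hη : 0 ≤ η := (norm_nonneg _).trans hx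
  have hD : 0 ≤ D := (norm_nonneg _).trans hxD
  have hyx := norm_sub_le_two_mul hxD hyD
  have hne := norm_resolvent_sub_le hA ⟨p, 0, hp⟩ hσ y x
  set Jy := resolvent A σ y with hJy
  set Jx := resolvent A σ x with hJx
  set b := g • (y - x) + d • (Jy - x) with hb
  have e : b = (y' - x) - l • (u - x) := by
    rw [hy', hb]
    have hx1 : x = (l + g + d) • x := by rw [hsum, one_smul]
    nth_rewrite 3 [hx1]
    module
  have h1 : ‖y' - x‖ ^ 2 ≤ ‖b‖ ^ 2 + 2 * l * inner ℝ (u - x) (y' - x) := by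
    rw [e, norm_sub_sq_real (y' - x), real_inner_smul_right, real_inner_comm (u - x)]
    have := sq_nonneg ‖l • (u - x)‖
    linarith
  have h2 : ‖Jy - x‖ ≤ ‖y - x‖ + η :=
    (norm_sub_le_norm_sub_add_norm_sub _ Jx _).trans (add_le_add hne hx)
  have h3 : ‖b‖ ≤ (1 - l) * ‖y - x‖ + η := by
    rw [hb]
    refine (norm_add_le _ _).trans ?_
    rw [norm_smul, norm_smul, Real.norm_of_nonneg hg, Real.norm_of_nonneg hd]
    have h4 := mul_le_mul_of_nonneg_left h2 hd
    have h5 : d * η ≤ 1 * η := mul_le_mul_of_nonneg_right (by linarith) hη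
    have h6 : 1 - l = g + d := by linarith
    rw [h6]
    linarith
  have h4 : ‖b‖ ^ 2 ≤ ((1 - l) * ‖y - x‖ + η) ^ 2 := pow_le_pow_left₀ (norm_nonneg _) h3 2
  have hl1 : 0 ≤ 1 - l := by linarith
  have h5 : (1 - l) * ((1 - l) * ‖y - x‖ ^ 2) ≤ 1 * ((1 - l) * ‖y - x‖ ^ 2) :=
    mul_le_mul_of_nonneg_right (by linarith) (by positivity)
  have h6 : (1 - l) * (‖y - x‖ * η) ≤ 1 * (‖y - x‖ * η) :=
    mul_le_mul_of_nonneg_right (by linarith) (by positivity)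
  have h7 : ‖y - x‖ * η ≤ 2 * D * η := mul_le_mul_of_nonneg_right hyx hη
  have h8 : η * η ≤ η * 1 := mul_le_mul_of_nonneg_left hη1 hη
  nlinarith

/-- Passing from the parameter `1 / c` to `σ ≤ C N` multiplies the residual by at most `c * C N`,
which is the factor built into `zeta`. -/
theorem norm_resolvent_sub_self_le_of_zeta (hA : IsMaximalMonotoneOp A)
    (hne : ∃ a, (A a).Nonempty) {c : ℕ} (hc : c ≠ 0) {C : ℕ → ℕ} (hCm : Monotone C) {k N i : ℕ}
    (hi : i ≤ N) {σ : ℝ} (hσc : 1 / (c : ℝ) ≤ σ) (hσC : σ ≤ C i) {x : H} {η : ℝ}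
    (hη : η ≤ 1 / ((zeta c C k N : ℝ) + 1)) (hx : ‖resolvent A (1 / (c : ℝ)) x - x‖ ≤ η) :
    ‖resolvent A σ x - x‖ ≤ 1 / ((k : ℝ) + 1) := by
  have hc' : (0 : ℝ) < c := Nat.cast_pos.2 (Nat.pos_of_ne_zero hc)
  have hσ : 0 < σ := (one_div_pos.2 hc').trans_le hσc
  have hCN : σ ≤ C N := hσC.trans (Nat.cast_le.2 (hCm hi))
  have hCpos : (0 : ℝ) < C N := hσ.trans_le hCN
  have hCpos' : C N ≠ 0 := by
    intro h0
    rw [h0, Nat.cast_zero] at hCpos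
    exact lt_irrefl _ hCpos
  have h1 := mul_norm_resolvent_sub_self_le hA hne (one_div_pos.2 hc') hσc x
  have h2 := hx.trans hη
  have e : (zeta c C k N : ℝ) + 1 = c * ((k : ℝ) + 1) * C N := by
    unfold zeta
    rw [cast_sub_one_add_one (by positivity)]
    push_cast
    ring
  rw [e] at h2
  have h3 : σ * ‖resolvent A (1 / (c : ℝ)) x - x‖ ≤ C N * (1 / (c * ((k : ℝ) + 1) * C N)) :=
    mul_le_mul hCN h2 (norm_nonneg _) hCpos.le
  have h4 : (C N : ℝ) * (1 / (c * ((k : ℝ) + 1) * C N)) = 1 / (c : ℝ) * (1 / ((k : ℝ) + 1)) := by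
    field_simp
  rw [h4] at h3
  exact le_of_mul_le_mul_left (h1.trans h3) (one_div_pos.2 hc')

end Step

/-! ### Residual bounds in the two cases -/

section ExactIteration

variable {H : Type*} [NormedAddCommGroup H] [InnerProductSpace ℝ H] [CompleteSpace H]
  {A : H → Set H}

/-- Multiplying the step estimate by `c` absorbs `d ≥ 1 / c`; the factor `9 / 4 * D ^ 2` bounds `‖u
- x‖²`, since `‖u - x‖ ≤ D / 2 + D`. -/
theorem norm_resolvent_sub_self_le_of_drop (hA : IsMaximalMonotoneOp A) {p : H} (hp : p ∈ zeros A)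
    {σ : ℝ} (hσ : 0 < σ) {u x y y' : H} {l g d η D c ρ : ℝ} (hl : 0 ≤ l) (hg : 0 ≤ g)
    (hc : 0 < c) (hd : 1 / c ≤ d) (hsum : l + g + d = 1) (hη1 : η ≤ 1)
    (hx : ‖resolvent A σ x - x‖ ≤ η) (hu : 2 * ‖u - p‖ ≤ D) (hxD : ‖x - p‖ ≤ D)
    (hyD : ‖y - p‖ ≤ D) (hy' : y' = l • u + g • y + d • resolvent A σ y) (hρ : 0 ≤ ρ)
    (h : c * (‖y - x‖ ^ 2 - ‖y' - x‖ ^ 2) + c * (l * (9 / 4 * D ^ 2)) + c * (η * (6 * D + 1)) ≤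
      ρ ^ 2) :
    ‖resolvent A σ y - y‖ ≤ ρ := by
  have hd0 : 0 ≤ d := (one_div_pos.2 hc).le.trans hd
  have h1 := del_mul_norm_resolvent_sub_sq_le hA hp hσ hl hg hd0 hsum hη1 hx hxD hyD hy'
  have hux : ‖u - x‖ ≤ 3 / 2 * D := by
    have := norm_sub_le (u - p) (x - p)
    rw [sub_sub_sub_cancel_right] at this
    linarith
  have h2 : ‖u - x‖ ^ 2 ≤ 9 / 4 * D ^ 2 :=
    (pow_le_pow_left₀ (norm_nonneg _) hux 2).trans_eq (by ring)
  have h3 := mul_le_mul_of_nonneg_left h2 hl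
  have h4 : 1 ≤ c * d := by
    rw [div_le_iff₀ hc] at hd
    linarith
  have h5 : 1 * ‖resolvent A σ y - y‖ ^ 2 ≤ c * d * ‖resolvent A σ y - y‖ ^ 2 :=
    mul_le_mul_of_nonneg_right h4 (sq_nonneg _)
  have h6 := mul_le_mul_of_nonneg_left h1 hc.le
  have h7 := mul_le_mul_of_nonneg_left h3 hc.le
  refine abs_le_of_sq_le_sq' ?_ hρ |>.2
  linarith

/-- Residual bound on an almost constant stretch of `‖y - x‖`. -/
theorem norm_resolvent_sub_self_le_of_almost_constant (hA : IsMaximalMonotoneOp A) {p : H}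
    (hp : p ∈ zeros A) {σ : ℝ} (hσ : 0 < σ) {u x y y' : H} {l g d D c ν κ : ℝ} (hl : 0 ≤ l)
    (hg : 0 ≤ g) (hc : 1 ≤ c) (hD : 1 ≤ D) (hν : 1 ≤ ν) (hκ : 11 * c * ν ^ 2 ≤ κ)
    (hd : 1 / c ≤ d) (hsum : l + g + d = 1)
    (hx : ‖resolvent A σ x - x‖ ≤ 1 / (2 * (6 * D + 1) * κ)) (hu : 2 * ‖u - p‖ ≤ D)
    (hxD : ‖x - p‖ ≤ D) (hyD : ‖y - p‖ ≤ D) (hy' : y' = l • u + g • y + d • resolvent A σ y)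
    (hdrop : ‖y - x‖ ^ 2 - ‖y' - x‖ ^ 2 ≤ 1 / (12 * c * ν ^ 2))
    (hlam : l ≤ 1 / (96 * c * D ^ 2 * ν ^ 2)) :
    ‖resolvent A σ y - y‖ ≤ 1 / ν := by
  have hν2 : 1 ≤ ν ^ 2 := one_le_pow₀ hν
  have hcν : 1 ≤ c * ν ^ 2 := one_le_mul_of_one_le_of_one_le hc hν2
  have hκ1 : 1 ≤ κ := by linarith
  refine norm_resolvent_sub_self_le_of_drop hA hp hσ hl hg (by linarith) hd hsum ?_ hx hu hxD hyD
    hy' (by positivity) ?_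
  · rw [div_le_one (by positivity)]
    nlinarith
  · have h1 : c * (‖y - x‖ ^ 2 - ‖y' - x‖ ^ 2) ≤ c * (1 / (12 * c * ν ^ 2)) := by gcongr
    have h2 : c * (l * (9 / 4 * D ^ 2)) ≤ c * (1 / (96 * c * D ^ 2 * ν ^ 2) * (9 / 4 * D ^ 2)) := by
      gcongr
    have h3 : c * (1 / (2 * (6 * D + 1) * κ) * (6 * D + 1)) ≤
        c * (1 / (2 * (6 * D + 1) * (11 * c * ν ^ 2)) * (6 * D + 1)) := by gcongr
    have e1 : c * (1 / (12 * c * ν ^ 2)) = 1 / 12 * (1 / ν) ^ 2 := by field_simp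
    have e2 : c * (1 / (96 * c * D ^ 2 * ν ^ 2) * (9 / 4 * D ^ 2)) = 9 / 384 * (1 / ν) ^ 2 := by
      field_simp; norm_num
    have e3 : c * (1 / (2 * (6 * D + 1) * (11 * c * ν ^ 2)) * (6 * D + 1)) =
        1 / 22 * (1 / ν) ^ 2 := by field_simp; norm_num
    rw [e1] at h1
    rw [e2] at h2
    rw [e3] at h3
    have := sq_nonneg (1 / ν)
    linarith

/-- Residual bound at an index where `‖y - x‖` increases. -/
theorem norm_resolvent_sub_self_le_of_increase (hA : IsMaximalMonotoneOp A) {p : H}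
    (hp : p ∈ zeros A) {σ : ℝ} (hσ : 0 < σ) {u x y y' : H} {l g d D c ρ η : ℝ} (hl : 0 ≤ l)
    (hg : 0 ≤ g) (hc : 1 ≤ c) (hD : 1 ≤ D) (hρ : 1 ≤ ρ) (hη : η ≤ 1 / (4 * c * ρ ^ 2 * (6 * D + 1)))
    (hd : 1 / c ≤ d) (hsum : l + g + d = 1) (hx : ‖resolvent A σ x - x‖ ≤ η)
    (hu : 2 * ‖u - p‖ ≤ D) (hxD : ‖x - p‖ ≤ D) (hyD : ‖y - p‖ ≤ D)
    (hy' : y' = l • u + g • y + d • resolvent A σ y) (hinc : ‖y - x‖ ^ 2 ≤ ‖y' - x‖ ^ 2)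
    (hlam : l ≤ 1 / (16 * c * ρ ^ 2 * D ^ 2)) :
    ‖resolvent A σ y - y‖ ≤ 1 / ρ := by
  have hρ2 : 1 ≤ ρ ^ 2 := one_le_pow₀ hρ
  have hcρ : 1 ≤ c * ρ ^ 2 := one_le_mul_of_one_le_of_one_le hc hρ2
  have hx' := hx.trans hη
  refine norm_resolvent_sub_self_le_of_drop hA hp hσ hl hg (by linarith) hd hsum ?_ hx' hu hxD hyD
    hy' (by positivity) ?_
  · rw [div_le_one (by positivity)]
    nlinarith
  · have h1 : c * (‖y - x‖ ^ 2 - ‖y' - x‖ ^ 2) ≤ 0 :=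
      mul_nonpos_of_nonneg_of_nonpos (by linarith) (by linarith)
    have h2 : c * (l * (9 / 4 * D ^ 2)) ≤ c * (1 / (16 * c * ρ ^ 2 * D ^ 2) * (9 / 4 * D ^ 2)) := by
      gcongr
    have e2 : c * (1 / (16 * c * ρ ^ 2 * D ^ 2) * (9 / 4 * D ^ 2)) = 9 / 64 * (1 / ρ) ^ 2 := by
      field_simp; norm_num
    have e3 : c * (1 / (4 * c * ρ ^ 2 * (6 * D + 1)) * (6 * D + 1)) = 1 / 4 * (1 / ρ) ^ 2 := by
      field_simp
    rw [e2] at h2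
    rw [e3]
    have := sq_nonneg (1 / ρ)
    linarith

/-- After an index where `‖y - x‖` increases, `y` is close to the approximate projection `x`. -/
theorem norm_sub_sq_le_of_increase (hA : IsMaximalMonotoneOp A) {p : H} (hp : p ∈ zeros A)
    {σ : ℝ} (hσ : 0 < σ) {u x y y' : H} {l g d D κ ρ b η : ℝ} (hl : 0 < l) (hg : 0 ≤ g) (hd : 0 ≤ d)
    (hD : 1 ≤ D) (hκ : 1 ≤ κ) (hρ : 128 * D * κ ^ 2 ≤ ρ) (hb : 1 ≤ b) (hbl : 1 / b ≤ l)
    (hη : η ≤ 1 / (16 * b * κ ^ 2 * (6 * D + 1)))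
    (hsum : l + g + d = 1) (hx : ‖resolvent A σ x - x‖ ≤ η)
    (hu : 2 * ‖u - p‖ ≤ D) (hxD : ‖x - p‖ ≤ D) (hyD : ‖y - p‖ ≤ D)
    (hy' : y' = l • u + g • y + d • resolvent A σ y) (hinc : ‖y - x‖ ^ 2 ≤ ‖y' - x‖ ^ 2)
    (hlam : l ≤ 1 / (256 * D ^ 2 * κ ^ 2)) (hres : ‖resolvent A σ y - y‖ ≤ 1 / ρ)
    (hproj : inner ℝ (u - x) (y - x) ≤ 1 / (32 * κ ^ 2)) :
    ‖y' - x‖ ^ 2 ≤ (21 / 50 * (1 / κ)) ^ 2 := by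
  have hκ2 : 1 ≤ κ ^ 2 := one_le_pow₀ hκ
  have hbκ : 1 ≤ b * κ ^ 2 := one_le_mul_of_one_le_of_one_le hb hκ2
  have hη1 : 1 / (16 * b * κ ^ 2 * (6 * D + 1)) ≤ 1 := by
    rw [div_le_one (by positivity)]
    nlinarith
  have h1 := norm_step_sub_sq_le hA hp hσ hl.le hg hd hsum hη1 (hx.trans hη) hxD hyD hy'
  have hux : ‖u - x‖ ≤ 3 / 2 * D := by
    have := norm_sub_le (u - p) (x - p)
    rw [sub_sub_sub_cancel_right] at this
    linarith
  have huy : ‖u - y‖ ≤ 3 / 2 * D := by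
    have := norm_sub_le (u - p) (y - p)
    rw [sub_sub_sub_cancel_right] at this
    linarith
  have hyy : ‖y' - y‖ ≤ 1 / (256 * D ^ 2 * κ ^ 2) * (3 / 2 * D) + 1 / (128 * D * κ ^ 2) := by
    refine (norm_step_sub_le hl.le hd hsum hy').trans (add_le_add ?_ ?_)
    · exact mul_le_mul hlam huy (norm_nonneg _) (by positivity)
    · have h2 : d * ‖resolvent A σ y - y‖ ≤ 1 * ‖resolvent A σ y - y‖ :=
        mul_le_mul_of_nonneg_right (by linarith) (norm_nonneg _)
      have h3 : 1 / ρ ≤ 1 / (128 * D * κ ^ 2) := one_div_le_one_div_of_le (by positivity) hρ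
      linarith
  have hin : inner ℝ (u - x) (y' - y) ≤
      3 / 2 * D * (1 / (256 * D ^ 2 * κ ^ 2) * (3 / 2 * D) + 1 / (128 * D * κ ^ 2)) :=
    (real_inner_le_norm _ _).trans (mul_le_mul hux hyy (norm_nonneg _) (by positivity))
  have e1 : 3 / 2 * D * (1 / (256 * D ^ 2 * κ ^ 2) * (3 / 2 * D) + 1 / (128 * D * κ ^ 2)) =
      21 / 1024 * (1 / κ) ^ 2 := by
    field_simp; norm_num
  have e2 : 1 / (32 * κ ^ 2) = 1 / 32 * (1 / κ) ^ 2 := by field_simp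
  rw [e1] at hin
  rw [e2] at hproj
  have hsplit : inner ℝ (u - x) (y' - x) ≤ 53 / 1024 * (1 / κ) ^ 2 := by
    have e : y' - x = (y - x) + (y' - y) := by abel
    rw [e, inner_add_right]
    linarith
  have h4 : 1 / (16 * b * κ ^ 2 * (6 * D + 1)) * (4 * D + 1) ≤ l * (1 / 16 * (1 / κ) ^ 2) := by
    have h5 : 1 / (16 * b * κ ^ 2 * (6 * D + 1)) * (4 * D + 1) ≤
        1 / (16 * b * κ ^ 2 * (6 * D + 1)) * (6 * D + 1) := by gcongr; norm_num
    have e3 : 1 / (16 * b * κ ^ 2 * (6 * D + 1)) * (6 * D + 1) = 1 / b * (1 / 16 * (1 / κ) ^ 2) := by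
      field_simp
    rw [e3] at h5
    exact h5.trans (mul_le_mul_of_nonneg_right hbl (by positivity))
  have hl1 : 0 ≤ 1 - l := by linarith
  have h6 := mul_le_mul_of_nonneg_left hinc hl1
  have h7 := mul_le_mul_of_nonneg_left hsplit hl.le
  have h8 : l * ‖y' - x‖ ^ 2 ≤ l * (2 * (53 / 1024 * (1 / κ) ^ 2) + 1 / 16 * (1 / κ) ^ 2) := by
    -- The increase lets `(1 - l) ‖y - x‖²` be absorbed on the left, leaving `l ‖y' - x‖²`. The
    -- defect of `x` is at most a multiple of `1 / b ≤ l`, so the whole inequality can be divided by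
    -- `l`.
    linarith
  have h9 := le_of_mul_le_mul_left h8 hl
  have := sq_nonneg (1 / κ)
  -- `2 * 53 / 1024 + 1 / 16 = 170 / 1024`, which is below `(21 / 50) ^ 2`.
  linarith

theorem norm_resolvent_sub_self_le_of_close (hA : IsMaximalMonotoneOp A) (hne : ∃ a, (A a).Nonempty)
    {σ : ℝ} (hσ : 0 < σ) (x y : H) :
    ‖resolvent A σ y - y‖ ≤ 2 * ‖y - x‖ + ‖resolvent A σ x - x‖ := by
  have h1 := norm_resolvent_sub_le hA hne hσ y x
  have e : resolvent A σ y - y =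
      (resolvent A σ y - resolvent A σ x) + (resolvent A σ x - x) - (y - x) := by abel
  rw [e]
  have h2 := norm_sub_le ((resolvent A σ y - resolvent A σ x) + (resolvent A σ x - x)) (y - x)
  have h3 := norm_add_le (resolvent A σ y - resolvent A σ x) (resolvent A σ x - x)
  linarith

end ExactIteration

/-! ### Monotonicity of the bounding functions -/

section Bounds

theorem r1_mono (c : ℕ) : Monotone (r1 c) := fun m n h => by unfold r1; gcongr

theorem r3_mono (k c : ℕ) {l : ℕ → ℕ} (hl : Monotone l) (D : ℕ) : Monotone (r3 k c l D) :=
  fun m n h => hl (by unfold r2; gcongr)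

theorem fTildeTwo_mono (k : ℕ) {f L : ℕ → ℕ} (hf : Monotone f) (hL : Monotone L) (D : ℕ) :
    Monotone (fTildeTwo k f L D) :=
  fun m n h => Nat.add_le_add_right (hf (by unfold sigmaBar; gcongr; exact hL (by gcongr))) 2

theorem le_sigmaBar {L : ℕ → ℕ} (hL : ∀ k, k ≤ L k) (D k n : ℕ) : n ≤ sigmaBar L D k n :=
  ((Nat.le_add_right _ _).trans (hL _)).trans (Nat.le_succ _)

theorem phi2_eq_iterate (D k : ℕ) {n : ℕ} {g : ℕ → ℕ} (hg : Monotone g) (hn : n ≤ g n) :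
    phi2 D k n g = g^[4 * D ^ 2 * (k + 1)] n :=
  max_eq_right (hg.monotone_iterate_of_le_map hn (Nat.zero_le _))

/-- Only the smaller side needs `n ≤ g n`; on the larger side the iterate is bounded by the maximum
in `phi2`. -/
theorem phi2_mono (D : ℕ) {k k' n n' : ℕ} {g : ℕ → ℕ} (hg : Monotone g) (hn : n ≤ g n)
    (hk : k ≤ k') (hnn : n ≤ n') : phi2 D k n g ≤ phi2 D k' n' g := by
  rw [phi2_eq_iterate D k hg hn]
  refine le_trans ?_ (le_max_right _ _)
  refine (hg.monotone_iterate_of_le_map hn (?_ : 4 * D ^ 2 * (k + 1) ≤ 4 * D ^ 2 * (k' + 1))).trans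
    (hg.iterate _ hnn)
  gcongr

end Bounds

/-! ### Metastable regularity of the exact iteration -/

section Metastability

variable {H : Type*} [NormedAddCommGroup H] [InnerProductSpace ℝ H] [CompleteSpace H]
  {A : H → Set H}

/-- The exact iteration stays in the ball around a zero of the operator. -/
theorem norm_iterate_sub_le (hA : IsMaximalMonotoneOp A) {p : H} (hp : p ∈ zeros A) {u : H}
    {cs lam gam del : ℕ → ℝ} (hcs : ∀ n, 0 < cs n) (hlam : ∀ n, lam n ∈ Set.Ioo (0 : ℝ) 1)
    (hdel : ∀ n, del n ∈ Set.Ioo (0 : ℝ) 1) (hgam : ∀ n, gam n ∈ Set.Ico (0 : ℝ) 1)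
    (hsum : ∀ n, lam n + gam n + del n = 1) {y : ℕ → H}
    (hy : ∀ n, y (n + 1) = lam n • u + gam n • y n + del n • resolvent A (cs n) (y n)) {D : ℝ}
    (hu : ‖u - p‖ ≤ D) (hy0 : ‖y 0 - p‖ ≤ D) (n : ℕ) : ‖y n - p‖ ≤ D := by
  induction n with
  | zero => exact hy0
  | succ n ih =>
    have hJ := (norm_resolvent_sub_zero_le hA hp (hcs n) (y n)).trans ih
    have e : y (n + 1) - p = lam n • (u - p) + gam n • (y n - p) +
        del n • (resolvent A (cs n) (y n) - p) := by
      have hp1 : p = (lam n + gam n + del n) • p := by rw [hsum, one_smul]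
      rw [hy]
      nth_rewrite 1 [hp1]
      module
    rw [e]
    refine (norm_add₃_le).trans ?_
    rw [norm_smul, norm_smul, norm_smul, Real.norm_of_nonneg (hlam n).1.le,
      Real.norm_of_nonneg (hgam n).1, Real.norm_of_nonneg (hdel n).1.le]
    have h1 := mul_le_mul_of_nonneg_left hu (hlam n).1.le
    have h2 := mul_le_mul_of_nonneg_left ih (hgam n).1
    have h3 := mul_le_mul_of_nonneg_left hJ (hdel n).1.le
    have h4 : lam n * D + gam n * D + del n * D = D := by rw [← add_mul, ← add_mul, hsum, one_mul]
    linarith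

theorem le_of_r3_le {lam : ℕ → ℝ} {l : ℕ → ℕ} (hlm : Monotone l)
    (hl : ∀ k n : ℕ, l k ≤ n → lam n ≤ 1 / ((k : ℝ) + 1)) {k c D n i : ℕ} (hc : c ≠ 0) (hD : D ≠ 0)
    (hi : r3 k c l D n ≤ i) :
    lam i ≤ 1 / (96 * (c : ℝ) * (D : ℝ) ^ 2 * ((n : ℝ) + 1) ^ 2) ∧
    lam i ≤ 1 / (256 * (D : ℝ) ^ 2 * ((k : ℝ) + 1) ^ 2) ∧
    lam i ≤ 1 / (16 * (c : ℝ) * (r2 k D n : ℝ) ^ 2 * (D : ℝ) ^ 2) := by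
  refine ⟨?_, ?_, ?_⟩
  · have h := hl _ i ((hlm ((le_max_left _ _).trans (le_max_left _ _))).trans hi)
    rw [cast_sub_one_add_one (by positivity)] at h
    exact_mod_cast h
  · have h := hl _ i ((hlm ((le_max_right _ _).trans (le_max_left _ _))).trans hi)
    rw [cast_sub_one_add_one (by positivity)] at h
    exact_mod_cast h
  · have h := hl _ i ((hlm (le_max_right _ _)).trans hi)
    have hr2 : 0 < r2 k D n := lt_of_lt_of_le (by positivity) (le_max_left _ _)
    refine h.trans (one_div_le_one_div_of_le (by positivity) ?_)
    push_cast
    linarith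

/-- Metastable asymptotic regularity of the exact iteration. -/
theorem exists_le_mu (hA : IsMaximalMonotoneOp A) {p : H} (hp : p ∈ zeros A) {u : H}
    {cs lam gam del : ℕ → ℝ} (hcs : ∀ n, 0 < cs n) (hlam : ∀ n, lam n ∈ Set.Ioo (0 : ℝ) 1)
    (hdel : ∀ n, del n ∈ Set.Ioo (0 : ℝ) 1) (hgam : ∀ n, gam n ∈ Set.Ico (0 : ℝ) 1)
    (hsum : ∀ n, lam n + gam n + del n = 1) {y : ℕ → H}
    (hy : ∀ n, y (n + 1) = lam n • u + gam n • y n + del n • resolvent A (cs n) (y n))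
    {c : ℕ} (hc : c ≠ 0) {h l L : ℕ → ℕ} (hh : ∀ n, h n ≠ 0)
    (hhm : Monotone h) (hlm : Monotone l) (hLm : Monotone L)
    (hQ1 : ∀ n, 1 / (h n : ℝ) ≤ lam n)
    (hQ2 : ∀ k n : ℕ, l k ≤ n → lam n ≤ 1 / ((k : ℝ) + 1))
    (hL : ∀ k, k ≤ L k)
    (hQ4 : ∀ n, 1 / (c : ℝ) ≤ min (cs n) (del n ^ 2))
    {D : ℕ} (hD0 : D ≠ 0) (hu : 2 * ‖u - p‖ ≤ D) (hyD : ∀ n, ‖y n - p‖ ≤ D)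
    {C : ℕ → ℕ} (hCm : Monotone C) (hC : ∀ n, cs n ≤ (C n : ℝ))
    (k : ℕ) {f : ℕ → ℕ} (hf : Monotone f) :
    ∃ n ≤ mu c C l L D h k f, ∀ i ∈ Set.Icc n (f n),
      ‖resolvent A (cs i) (y i) - y i‖ ≤ 1 / ((k : ℝ) + 1) := by
  have hne : ∃ a, (A a).Nonempty := ⟨p, 0, hp⟩
  have hc1 : (1 : ℝ) ≤ c := Nat.one_le_cast.2 (Nat.one_le_iff_ne_zero.2 hc)
  have hD1 : (1 : ℝ) ≤ D := Nat.one_le_cast.2 (Nat.one_le_iff_ne_zero.2 hD0)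
  have hk1 : (1 : ℝ) ≤ (k : ℝ) + 1 := le_add_of_nonneg_left (Nat.cast_nonneg k)
  have hcpos : (0 : ℝ) < 1 / (c : ℝ) := one_div_pos.2 (by linarith)
  have hcsc : ∀ n, 1 / (c : ℝ) ≤ cs n := fun n => (hQ4 n).trans (min_le_left _ _)
  have hdelc : ∀ n, 1 / (c : ℝ) ≤ del n := fun n => by
    refine ((hQ4 n).trans (min_le_right _ _)).trans ?_
    have := mul_le_mul_of_nonneg_left (hdel n).2.le (hdel n).1.le
    rw [sq]
    linarith
  obtain ⟨n, hnb, hkn, x, hxD, hTx, hproj⟩ := exists_approx_projection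
    (norm_resolvent_sub_le hA hne hcpos) (resolvent_eq_self hA hp hcpos) hD0 hu
    (32 * (k + 1) ^ 2 - 1) (Xi k f c C l L D h)
  have hkn' : k ≤ n := le_trans (by
    have : k + 1 ≤ 32 * (k + 1) ^ 2 := by nlinarith
    omega) hkn
  set g := fTildeTwo k f L D with hg
  have hgm : Monotone g := fTildeTwo_mono k hf hLm D
  set m := r3 k c l D n with hm
  set r := r1 c n with hr
  set b := betaXi c C l L D h k f with hb
  have hnb' : n ≤ b := hnb
  have hmb : m ≤ r3 k c l D b := r3_mono k c hlm D hnb'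
  -- If `f m < m`, the interval at `m` is empty and `m` is a witness; otherwise `m ≤ g m`, which
  -- makes the iterates of `g` increase from `m`.
  rcases lt_or_ge (f m) m with hfm | hfm
  · refine ⟨m, ?_, fun i hi => absurd (hi.1.trans hi.2) (not_le.2 hfm)⟩
    exact ((hmb.trans (le_max_left _ _)).trans (le_sigmaBar hL D k _)).trans (le_max_left _ _)
  have hmg : m ≤ g m :=
    (hfm.trans (hf (le_sigmaBar hL D k m))).trans (Nat.le_add_right _ 2)
  have hphi2 : phi2 D r m g = g^[4 * D ^ 2 * (r + 1)] m := phi2_eq_iterate D r hgm hmg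
  set M := phi2 D r m g with hM
  have hMg : M ≤ g M := by
    rw [hphi2, ← Function.iterate_succ_apply' g]
    exact hgm.monotone_iterate_of_le_map hmg (Nat.le_succ _)
  have hMb : M ≤ phi2 D (r1 c b) (r3 k c l D b) g := phi2_mono D hgm hmg (r1_mono c hnb') hmb
  -- In the monotone case the residuals are read off from the small drops, and only `n ≤ sigmaBar L
  -- D k n` is used of `sigmaBar`.
  by_cases hcase : ∀ i, m ≤ i → i < M → ‖y (i + 1) - x‖ ^ 2 ≤ ‖y i - x‖ ^ 2
  · obtain ⟨N, hmN, hNM, hN⟩ := exists_almost_constant (s := fun i => ‖y i - x‖ ^ 2) (r := r) hD0 hgm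
      hmg (fun i => sq_nonneg _)
      (fun i => (pow_le_pow_left₀ (norm_nonneg _) (norm_sub_le_two_mul hxD (hyD i)) 2).trans_eq
        (by ring)) (by rwa [hphi2] at hcase)
    rw [← hphi2] at hNM
    refine ⟨N, ?_, ?_⟩
    · exact ((hNM.trans hMb).trans (le_sigmaBar hL D k _)).trans (le_max_left _ _)
    · intro i hi
      -- The summand `2` in `fTildeTwo` leaves room for `i + 1`, since the drop at `i` involves `y
      -- (i + 1)`.
      have hig : i + 1 ≤ g N := by
        have h1 : f N ≤ f (sigmaBar L D k N) := hf (le_sigmaBar hL D k N)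
        have h2 : g N = f (sigmaBar L D k N) + 2 := rfl
        have h3 := hi.2
        omega
      have hiP : i ≤ g M := (Nat.le_of_succ_le hig).trans (hgm hNM)
      set κ : ℕ := max r (r4 k c f l D L n) with hκ
      have hr0 : 11 * c * (n + 1) ^ 2 ≤ r := by
        rw [hr]; unfold r1
        have : 1 ≤ c * (n + 1) ^ 2 := Nat.one_le_iff_ne_zero.2 (by positivity)
        have e1 : 12 * c * (n + 1) ^ 2 = 12 * (c * (n + 1) ^ 2) := by ring
        have e2 : 11 * c * (n + 1) ^ 2 = 11 * (c * (n + 1) ^ 2) := by ring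
        omega
      have hκr : 11 * c * (n + 1) ^ 2 ≤ κ := hr0.trans (le_max_left _ _)
      have hκ0 : κ ≠ 0 := by
        have : 0 < 11 * c * (n + 1) ^ 2 := by positivity
        omega
      have hx := norm_resolvent_sub_self_le_of_zeta hA hne hc hCm hiP (hcsc i) (hC i)
        (Nat.one_div_le_one_div (le_max_left (Xi1 k f c C l L D n) (Xi2 k f c C l L D h n))) hTx
      rw [cast_sub_one_add_one (by positivity)] at hx
      push_cast at hx
      have hdrop := hN i hi.1 hig
      rw [hr, r1, cast_sub_one_add_one (by positivity)] at hdrop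
      push_cast at hdrop
      refine (norm_resolvent_sub_self_le_of_almost_constant hA hp (hcs i) (ν := (n : ℝ) + 1)
        (κ := κ) (hlam i).1.le (hgam i).1 hc1 hD1 (le_add_of_nonneg_left (Nat.cast_nonneg n))
        (by exact_mod_cast hκr) (hdelc i) (hsum i) ?_ hu hxD (hyD i) (hy i) hdrop
        (le_of_r3_le hlm hQ2 hc hD0 (hmN.trans hi.1)).1).trans (Nat.one_div_le_one_div hkn')
      rw [hκ]
      push_cast
      exact hx
  · push Not at hcase
    obtain ⟨i₀, hmi, hiM, hi₀⟩ := hcase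
    -- Every `j ≥ g M ≥ M` lies beyond the increase at `i₀`, so a last increase before `j` exists;
    -- `Xi2` makes `x` accurate up to `f (g M)`.
    refine ⟨g M, ?_, ?_⟩
    · refine le_trans ?_ (le_max_right _ _)
      exact hgm hMb
    · intro j hj
      obtain ⟨t, hit, htj, ht, hjt⟩ := exists_last_increase (s := fun i => ‖y i - x‖ ^ 2)
        (hiM.trans_le (hMg.trans hj.1)) hi₀
      have htP : t ≤ f (g M) := htj.le.trans hj.2
      obtain ⟨-, hl2, hl3⟩ := le_of_r3_le hlm hQ2 hc hD0 (hmi.trans hit)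
      set K : ℕ := max (16 * h (f (g M)) * (k + 1) ^ 2 * (6 * D + 1))
        (4 * c * (r2 k D (g M)) ^ 2 * (6 * D + 1)) with hK
      have hXi2 : Xi2 k f c C l L D h n = zeta c C K (f (g M)) := rfl
      have hxi : ∀ i, i ≤ f (g M) → ‖resolvent A (cs i) x - x‖ ≤ 1 / ((K : ℝ) + 1) := by
        intro i hi
        refine norm_resolvent_sub_self_le_of_zeta hA hne hc hCm hi (hcsc i) (hC i) ?_ hTx
        rw [← hXi2]
        exact Nat.one_div_le_one_div (le_max_right _ _)
      have hr2a : 2 * (n + 1) ≤ r2 k D n := le_max_left _ _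
      have hr2b : 128 * D * (k + 1) ^ 2 ≤ r2 k D n := le_max_right _ _
      have hr2R : 128 * (D : ℝ) * ((k : ℝ) + 1) ^ 2 ≤ r2 k D n := by exact_mod_cast hr2b
      have hr21 : (1 : ℝ) ≤ r2 k D n := by
        have : 1 ≤ r2 k D n := by omega
        exact_mod_cast this
      have hh1 : (1 : ℝ) ≤ h (f (g M)) :=
        Nat.one_le_cast.2 (Nat.one_le_iff_ne_zero.2 (hh _))
      have hK1 : 16 * (h (f (g M)) : ℝ) * ((k : ℝ) + 1) ^ 2 * (6 * D + 1) ≤ (K : ℝ) + 1 := by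
        have : 16 * h (f (g M)) * (k + 1) ^ 2 * (6 * D + 1) ≤ K + 1 :=
          (le_max_left _ _).trans (Nat.le_succ _)
        exact_mod_cast this
      have hbl : 1 / (h (f (g M)) : ℝ) ≤ lam t := by
        refine le_trans (one_div_le_one_div_of_le ?_ (Nat.cast_le.2 (hhm htP))) (hQ1 t)
        exact Nat.cast_pos.2 (Nat.pos_of_ne_zero (hh t))
      -- `K` contains `r2` at `g M`, whereas accuracy in terms of `r2` at `n` is needed. Comparing
      -- the lower and upper bounds of `lam t` shows that `h (f (g M))` dominates the latter, so the
      -- first entry of `K` suffices.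
      have hhr : 16 * (c : ℝ) * (r2 k D n : ℝ) ^ 2 * (D : ℝ) ^ 2 ≤ h (f (g M)) :=
        (one_div_le_one_div (by linarith) (by positivity)).1 (hbl.trans hl3)
      have hK2 : 4 * (c : ℝ) * (r2 k D n : ℝ) ^ 2 * (6 * D + 1) ≤ (K : ℝ) + 1 := by
        refine le_trans ?_ hK1
        have h1 : (1 : ℝ) ≤ (D : ℝ) ^ 2 * ((k : ℝ) + 1) ^ 2 :=
          one_le_mul_of_one_le_of_one_le (one_le_pow₀ hD1) (one_le_pow₀ hk1)
        calc 4 * (c : ℝ) * (r2 k D n : ℝ) ^ 2 * (6 * D + 1)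
            ≤ 256 * (c : ℝ) * (r2 k D n : ℝ) ^ 2 * (6 * D + 1) * 1 := by
              rw [mul_one]; gcongr; norm_num
          _ ≤ 256 * (c : ℝ) * (r2 k D n : ℝ) ^ 2 * (6 * D + 1) *
              ((D : ℝ) ^ 2 * ((k : ℝ) + 1) ^ 2) := by gcongr
          _ = 16 * (16 * (c : ℝ) * (r2 k D n : ℝ) ^ 2 * (D : ℝ) ^ 2) * ((k : ℝ) + 1) ^ 2 *
              (6 * D + 1) := by ring
          _ ≤ _ := by gcongr
      have hη1 := one_div_le_one_div_of_le (by positivity) hK1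
      have hη2 := one_div_le_one_div_of_le (by positivity) hK2
      have hres := norm_resolvent_sub_self_le_of_increase hA hp (hcs t) (hlam t).1.le (hgam t).1
        hc1 hD1 hr21 hη2 (hdelc t) (hsum t) (hxi t htP) hu hxD (hyD t) (hy t) ht.le hl3
      have hpr : inner ℝ (u - x) (y t - x) ≤ 1 / (32 * ((k : ℝ) + 1) ^ 2) := by
        refine (hproj (y t) (hyD t) ?_).trans_eq ?_
        · refine (norm_resolvent_sub_self_mono hA hne hcpos (hcsc t) (y t)).trans (hres.trans ?_)
          refine one_div_le_one_div_of_le (by positivity) ?_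
          have : n + 1 ≤ r2 k D n := by omega
          exact_mod_cast this
        · rw [cast_sub_one_add_one (by positivity)]
          push_cast
          rfl
      have hclose := norm_sub_sq_le_of_increase hA hp (hcs t) (hlam t).1 (hgam t).1 (hdel t).1.le hD1
        hk1 hr2R hh1 hbl hη1 (hsum t) (hxi t htP) hu hxD (hyD t) (hy t) ht.le hl2 hres hpr
      have hyj := abs_le_of_sq_le_sq' (hjt.trans hclose) (by positivity) |>.2
      have hfin := norm_resolvent_sub_self_le_of_close hA hne (hcs j) x (y j)
      have hxj := (hxi j hj.2).trans hη1
      have hlast : 1 / (16 * (h (f (g M)) : ℝ) * ((k : ℝ) + 1) ^ 2 * (6 * D + 1)) ≤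
          1 / 16 * (1 / ((k : ℝ) + 1)) := by
        rw [one_div_mul_one_div]
        refine one_div_le_one_div_of_le (by positivity) ?_
        have h1 : (1 : ℝ) ≤ h (f (g M)) * ((k : ℝ) + 1) * (6 * D + 1) :=
          one_le_mul_of_one_le_of_one_le (one_le_mul_of_one_le_of_one_le hh1 hk1) (by linarith)
        have h2 := mul_le_mul_of_nonneg_left h1 (by positivity : 0 ≤ 16 * ((k : ℝ) + 1))
        linarith
      have : 0 < 1 / ((k : ℝ) + 1) := by positivity
      -- The constants add up to `2 * 21 / 50 + 1 / 16 < 1`.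
      linarith

end Metastability

/-! ### Comparison of the iteration with errors and the exact one -/

section Perturbation

/-- Unrolling of the recursion `a (n + 1) ≤ (1 - λ n) a n + ε n` from an index `N + 1` on. -/
theorem le_exp_neg_sum_mul_add {a lam eps b : ℕ → ℝ} (hlam : ∀ n, lam n ≤ 1)
    (ha : ∀ n, a (n + 1) ≤ (1 - lam n) * a n + eps n) {d : ℝ} (hd : 0 ≤ d) {N : ℕ}
    (haN : a (N + 1) ≤ d) (hb0 : 0 ≤ b 0)
    (hb : ∀ j, (1 - lam (N + 1 + j)) * b j + eps (N + 1 + j) ≤ b (j + 1)) (j : ℕ) :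
    a (N + 1 + j) ≤ Real.exp (-∑ i ∈ Finset.Icc (N + 1) (N + j), lam i) * d + b j := by
  induction j with
  | zero => simpa using haN.trans (le_add_of_nonneg_right hb0)
  | succ j ih =>
    have h1 := mul_le_mul_of_nonneg_left ih (sub_nonneg.2 (hlam (N + 1 + j)))
    have e : ∑ i ∈ Finset.Icc (N + 1) (N + (j + 1)), lam i =
        ∑ i ∈ Finset.Icc (N + 1) (N + j), lam i + lam (N + 1 + j) := by
      rw [← add_assoc, Finset.sum_Icc_succ_top (by omega), Nat.add_right_comm N 1 j]
    rw [e, neg_add, Real.exp_add]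
    set S := Real.exp (-∑ i ∈ Finset.Icc (N + 1) (N + j), lam i) with hS
    have h2 : (1 - lam (N + 1 + j)) * (S * d) ≤ Real.exp (-lam (N + 1 + j)) * (S * d) :=
      mul_le_mul_of_nonneg_right (Real.one_sub_le_exp_neg _)
        (mul_nonneg (Real.exp_pos _).le hd)
    have h3 := ha (N + 1 + j)
    have h4 := hb j
    rw [← add_assoc]
    linarith

/-- The sum up to `L (N + ⌈log …⌉)` is at least `N` plus the logarithm, and its first `N` terms
contribute at most `N`; the terms after `N` therefore add up to at least `log (3 d (k + 1))`. -/
theorem exp_neg_sum_mul_le {lam : ℕ → ℝ} (hlam : ∀ n, lam n ∈ Set.Ioo (0 : ℝ) 1) {L : ℕ → ℕ}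
    (hL : ∀ k : ℕ, (k : ℝ) ≤ ∑ i ∈ Finset.Icc 1 (L k), lam i) {d : ℝ} (hd : 0 < d) (k N : ℕ) {j : ℕ}
    (hj : L (N + ⌈Real.log (3 * d * ((k : ℝ) + 1))⌉₊) ≤ N + j) :
    Real.exp (-∑ i ∈ Finset.Icc (N + 1) (N + j), lam i) * d ≤ 1 / (3 * ((k : ℝ) + 1)) := by
  have h1 := hL (N + ⌈Real.log (3 * d * ((k : ℝ) + 1))⌉₊)
  have h2 : ∑ i ∈ Finset.Icc 1 (L (N + ⌈Real.log (3 * d * ((k : ℝ) + 1))⌉₊)), lam i ≤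
      ∑ i ∈ Finset.Icc 1 (N + j), lam i :=
    Finset.sum_le_sum_of_subset_of_nonneg (Finset.Icc_subset_Icc_right hj)
      fun i _ _ => (hlam i).1.le
  have h3 : ∑ i ∈ Finset.Icc 1 (N + j), lam i =
      ∑ i ∈ Finset.Icc 1 N, lam i + ∑ i ∈ Finset.Icc (N + 1) (N + j), lam i := by
    have := Finset.sum_Ioc_consecutive lam (Nat.zero_le N) (Nat.le_add_right N j)
    simpa only [← Finset.Icc_add_one_left_eq_Ioc, zero_add] using this.symm
  have h4 : ∑ i ∈ Finset.Icc 1 N, lam i ≤ N := by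
    refine (Finset.sum_le_sum fun i _ => (hlam i).2.le).trans_eq ?_
    rw [Finset.sum_const, Nat.card_Icc, nsmul_eq_mul, mul_one, Nat.add_sub_cancel]
  have h5 := Nat.le_ceil (Real.log (3 * d * ((k : ℝ) + 1)))
  push_cast at h1
  have h6 : Real.log (3 * d * ((k : ℝ) + 1)) ≤ ∑ i ∈ Finset.Icc (N + 1) (N + j), lam i := by
    linarith
  have hpos : 0 < 3 * d * ((k : ℝ) + 1) := by positivity
  have h7 : Real.exp (-∑ i ∈ Finset.Icc (N + 1) (N + j), lam i) ≤ (3 * d * ((k : ℝ) + 1))⁻¹ := by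
    rw [Real.exp_neg]
    exact inv_anti₀ hpos ((Real.log_le_iff_le_exp hpos).1 h6)
  refine (mul_le_mul_of_nonneg_right h7 hd.le).trans_eq ?_
  field_simp

variable {H : Type*} [NormedAddCommGroup H] [InnerProductSpace ℝ H] [CompleteSpace H]
  {A : H → Set H}

/-- The iteration with errors approaches the exact iteration. -/
theorem norm_sub_le_of_Theta_le (hA : IsMaximalMonotoneOp A) (hne : ∃ a, (A a).Nonempty) {u : H}
    {cs lam gam del : ℕ → ℝ} {e : ℕ → H} (hcs : ∀ n, 0 < cs n)
    (hlam : ∀ n, lam n ∈ Set.Ioo (0 : ℝ) 1) (hdel : ∀ n, del n ∈ Set.Ioo (0 : ℝ) 1)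
    (hgam : ∀ n, gam n ∈ Set.Ico (0 : ℝ) 1) (hsum : ∀ n, lam n + gam n + del n = 1)
    {z y : ℕ → H}
    (hz : ∀ n, z (n + 1) = lam n • u + gam n • z n + del n • resolvent A (cs n) (z n) + e n)
    (hy0 : y 0 = z 0)
    (hy : ∀ n, y (n + 1) = lam n • u + gam n • y n + del n • resolvent A (cs n) (y n))
    {L E : ℕ → ℕ} (hQ3 : ∀ k : ℕ, (k : ℝ) ≤ ∑ i ∈ Finset.Icc 1 (L k), lam i)
    (hQ5 : (∀ k n : ℕ, ∑ i ∈ Finset.Icc (E k + 1) (E k + n), ‖e i‖ ≤ 1 / ((k : ℝ) + 1)) ∨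
      (∀ k n : ℕ, E k ≤ n → ‖e n‖ / lam n ≤ 1 / ((k : ℝ) + 1)))
    {d0 d1 d2 : ℕ} (hd2 : d2 ≠ 0)
    (hd1b : ∑ i ∈ Finset.range (E 0 + 1), ‖e i‖ + 1 ≤ (d1 : ℝ))
    (hd2b : ∀ i ≤ E 0, ‖z i - y i‖ ≤ (d2 : ℝ)) (k : ℕ) {i : ℕ} (hi : Theta L E d0 d1 d2 k ≤ i) :
    ‖z i - y i‖ ≤ 1 / ((k : ℝ) + 1) := by
  set a : ℕ → ℝ := fun n => ‖z n - y n‖ with ha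
  set d : ℕ := max (2 * d0 + d1) d2 with hd
  have hstep : ∀ n, a (n + 1) ≤ (1 - lam n) * a n + ‖e n‖ := by
    intro n
    have e1 : z (n + 1) - y (n + 1) = gam n • (z n - y n) +
        del n • (resolvent A (cs n) (z n) - resolvent A (cs n) (y n)) + e n := by
      rw [hz, hy]
      module
    have h1 := mul_le_mul_of_nonneg_left (norm_resolvent_sub_le hA hne (hcs n) (z n) (y n))
      (hdel n).1.le
    have e2 : 1 - lam n = gam n + del n := by linarith [hsum n]
    rw [ha]
    dsimp only
    rw [e1, e2]
    refine (norm_add₃_le).trans ?_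
    rw [norm_smul, norm_smul, Real.norm_of_nonneg (hgam n).1, Real.norm_of_nonneg (hdel n).1.le]
    linarith
  have hd1d : (d1 : ℝ) ≤ d := Nat.cast_le.2 ((Nat.le_add_left _ _).trans (le_max_left _ _))
  have hd2d : (d2 : ℝ) ≤ d := Nat.cast_le.2 (le_max_right _ _)
  have hd21 : (1 : ℝ) ≤ d2 := Nat.one_le_cast.2 (Nat.one_le_iff_ne_zero.2 hd2)
  have hdpos : (0 : ℝ) < d := by linarith
  set N := E (3 * k + 2) with hN
  have hη : 1 / (((3 * k + 2 : ℕ) : ℝ) + 1) = 1 / (3 * ((k : ℝ) + 1)) := by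
    push_cast
    congr 1
    ring
  have hTheta : L (N + ⌈Real.log (3 * (d : ℝ) * ((k : ℝ) + 1))⌉₊) + 1 ≤ i := hi
  have hNL := le_of_le_sum (fun n => (hlam n).2.le) hQ3
    (N + ⌈Real.log (3 * (d : ℝ) * ((k : ℝ) + 1))⌉₊)
  obtain ⟨j, rfl⟩ : ∃ j, i = N + 1 + j := ⟨i - (N + 1), by omega⟩
  have hexp := exp_neg_sum_mul_le hlam hQ3 hdpos k N (j := j) (by omega)
  -- Initial distance and accumulated errors each contribute at most a third of the target. For
  -- summable errors `b` is their partial sum; for errors small relative to `lam` it is constant, as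
  -- `(1 - lam) b + lam b = b`.
  have htotal : ∀ b : ℕ → ℝ, 0 ≤ b 0 →
      (∀ j, (1 - lam (N + 1 + j)) * b j + ‖e (N + 1 + j)‖ ≤ b (j + 1)) →
      a (N + 1) ≤ d → b j ≤ 1 / (3 * ((k : ℝ) + 1)) → a (N + 1 + j) ≤ 1 / ((k : ℝ) + 1) := by
    intro b hb0 hb haN hbj
    have h1 := le_exp_neg_sum_mul_add (fun n => (hlam n).2.le) hstep hdpos.le haN hb0 hb j
    have h2 : 1 / (3 * ((k : ℝ) + 1)) = 1 / 3 * (1 / ((k : ℝ) + 1)) := by field_simp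
    have h3 : 0 < 1 / ((k : ℝ) + 1) := by positivity
    linarith
  rcases hQ5 with hQ | hQ
  · refine htotal (fun j => ∑ i ∈ Finset.Icc (N + 1) (N + j), ‖e i‖) ?_ ?_ ?_ ?_
    · exact Finset.sum_nonneg fun _ _ => norm_nonneg _
    · intro j
      rw [← add_assoc, Finset.sum_Icc_succ_top (by omega), Nat.add_right_comm N 1 j]
      have h1 : 0 ≤ ∑ i ∈ Finset.Icc (N + 1) (N + j), ‖e i‖ :=
        Finset.sum_nonneg fun _ _ => norm_nonneg _
      have h2 := mul_nonneg (hlam (N + j + 1)).1.le h1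
      linarith
    · have h1 : ∀ n, a n ≤ ∑ i ∈ Finset.range n, ‖e i‖ := by
        intro n
        induction n with
        | zero => simp [ha, hy0]
        | succ n ih =>
          rw [Finset.sum_range_succ]
          have h2 := mul_nonneg (hlam n).1.le (norm_nonneg (z n - y n))
          have h3 := hstep n
          have h4 : a n = ‖z n - y n‖ := rfl
          rw [← h4] at h2
          linarith
      refine (h1 (N + 1)).trans (le_trans ?_ hd1d)
      refine le_trans ?_ hd1b
      -- Enlarging the range allows a split at `E 0 + 1` whatever the order of `E 0` and `N`; the
      -- tail is at most `1`, the summand reserved in `d1`.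
      have h2 : ∑ i ∈ Finset.range (N + 1), ‖e i‖ ≤
          ∑ i ∈ Finset.range (E 0 + 1 + N), ‖e i‖ :=
        Finset.sum_le_sum_of_subset_of_nonneg
          (Finset.range_subset_range.2 (by omega)) fun _ _ _ => norm_nonneg _
      have h3 := hQ 0 N
      rw [Finset.range_eq_Ico (E 0 + 1 + N), ← Finset.sum_Ico_consecutive _
        (Nat.zero_le (E 0 + 1)) (Nat.le_add_right (E 0 + 1) N), ← Finset.range_eq_Ico] at h2
      have h4 : Finset.Ico (E 0 + 1) (E 0 + 1 + N) = Finset.Icc (E 0 + 1) (E 0 + N) := by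
        ext x
        simp only [Finset.mem_Ico, Finset.mem_Icc]
        omega
      rw [h4] at h2
      norm_num at h3
      linarith
    · exact (hQ (3 * k + 2) j).trans_eq hη
  · have he : ∀ k n, E k ≤ n → ‖e n‖ ≤ lam n * (1 / ((k : ℝ) + 1)) := fun k n hn => by
      have := hQ k n hn
      rwa [div_le_iff₀ (hlam n).1, mul_comm] at this
    refine htotal (fun _ => 1 / (3 * ((k : ℝ) + 1))) (by positivity) ?_ ?_ le_rfl
    · intro j
      have h1 := he (3 * k + 2) (N + 1 + j) (by omega)
      rw [hη] at h1
      linarith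
    · refine le_trans ?_ hd2d
      have h1 : ∀ n, a n ≤ d2 := by
        intro n
        induction n with
        | zero => exact hd2b 0 (Nat.zero_le _)
        | succ n ih =>
          rcases Nat.lt_or_ge n (E 0) with h2 | h2
          · exact hd2b (n + 1) h2
          -- Beyond `E 0` one has `‖e n‖ ≤ lam n ≤ lam n * d2`, so the bound `d2` is preserved by
          -- the convex combination.
          · have h3 := he 0 n h2
            rw [Nat.cast_zero, zero_add, div_one] at h3
            have h4 := mul_le_mul_of_nonneg_left ih (sub_nonneg.2 (hlam n).2.le)
            have h5 := mul_le_mul_of_nonneg_left hd21 (hlam n).1.le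
            linarith [hstep n]
      exact h1 (N + 1)

end Perturbation

end MPPA

/-! ### The rates for the iteration with errors -/

theorem mainTheorem3 {H : Type*} [NormedAddCommGroup H] [InnerProductSpace ℝ H]
    [CompleteSpace H]
    -- the operator
    (A : H → Set H) (hA : MPPA.IsMaximalMonotoneOp A)
    -- the parameters of the iterations
    (u : H) (cs lam gam del : ℕ → ℝ) (e : ℕ → H)
    (hcs : ∀ n, 0 < cs n) (hlam : ∀ n, lam n ∈ Set.Ioo (0 : ℝ) 1)
    (hdel : ∀ n, del n ∈ Set.Ioo (0 : ℝ) 1) (hgam : ∀ n, gam n ∈ Set.Ico (0 : ℝ) 1)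
    (hsum : ∀ n, lam n + gam n + del n = 1)
    -- the iteration with errors, and the exact iteration with the same starting point
    (z y : ℕ → H)
    (hz : ∀ n, z (n + 1) =
      lam n • u + gam n • z n + del n • MPPA.resolvent A (cs n) (z n) + e n)
    (hy0 : y 0 = z 0)
    (hy : ∀ n, y (n + 1) =
      lam n • u + gam n • y n + del n • MPPA.resolvent A (cs n) (y n))
    -- the quantitative conditions
    (c : ℕ) (hc : c ≠ 0) (h l L E : ℕ → ℕ) (hh : ∀ n, h n ≠ 0)
    (hhm : Monotone h) (hlm : Monotone l) (hLm : Monotone L) (hEm : Monotone E)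
    (hQ1 : ∀ n, 1 / (h n : ℝ) ≤ lam n)
    (hQ2 : ∀ k n : ℕ, l k ≤ n → lam n ≤ 1 / ((k : ℝ) + 1))
    (hQ3 : ∀ k : ℕ, (k : ℝ) ≤ ∑ i ∈ Finset.Icc 1 (L k), lam i)
    (hQ4 : ∀ n, 1 / (c : ℝ) ≤ min (cs n) (del n ^ 2))
    (hQ5 : (∀ k n : ℕ, ∑ i ∈ Finset.Icc (E k + 1) (E k + n), ‖e i‖ ≤ 1 / ((k : ℝ) + 1)) ∨
      (∀ k n : ℕ, E k ≤ n → ‖e n‖ / lam n ≤ 1 / ((k : ℝ) + 1)))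
    -- the majorants
    (D : ℕ) (hD0 : D ≠ 0)
    (hD : ∃ p ∈ MPPA.zeros A, max (2 * ‖u - p‖) ‖z 0 - p‖ ≤ (D : ℝ))
    (C : ℕ → ℕ) (hCm : Monotone C) (hC : ∀ n, cs n ≤ (C n : ℝ))
    (d0 d1 d2 : ℕ) (hd0 : d0 ≠ 0) (hd1 : d1 ≠ 0) (hd2 : d2 ≠ 0)
    (hd0b : ∃ p ∈ MPPA.zeros A, max ‖u - p‖ ‖z 0 - p‖ ≤ (d0 : ℝ))
    (hd1b : ∑ i ∈ Finset.range (E 0 + 1), ‖e i‖ + 1 ≤ (d1 : ℝ))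
    (hd2b : ∀ i ≤ E 0, ‖z i - y i‖ ≤ (d2 : ℝ))
    (k : ℕ) (f : ℕ → ℕ) (hf : Monotone f) :
    (∃ n ≤ MPPA.nuTilde c C l L D h E d0 d1 d2 k f, ∀ i ∈ Set.Icc n (f n),
      ‖MPPA.resolvent A (cs i) (z i) - z i‖ ≤ 1 / ((k : ℝ) + 1)) ∧
    (∃ n ≤ MPPA.nuTilde c C l L D h E d0 d1 d2 (2 * k + 1) f, ∀ i ∈ Set.Icc n (f n),
      ‖MPPA.resolvent A (1 / (c : ℝ)) (z i) - z i‖ ≤ 1 / ((k : ℝ) + 1)) := by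
  obtain ⟨p, hp, hpD⟩ := hD
  have hne : ∃ a, (A a).Nonempty := ⟨p, 0, hp⟩
  have hu : 2 * ‖u - p‖ ≤ D := (le_max_left _ _).trans hpD
  have hz0 : ‖y 0 - p‖ ≤ D := by rw [hy0]; exact (le_max_right _ _).trans hpD
  have hyD := MPPA.norm_iterate_sub_le hA hp hcs hlam hdel hgam hsum hy
    (by linarith [norm_nonneg (u - p)]) hz0
  have hL := MPPA.le_of_le_sum (fun n => (hlam n).2.le) hQ3
  have hc1 : 1 ≤ c := Nat.one_le_iff_ne_zero.2 hc
  have hregular : ∀ k, ∃ n ≤ MPPA.nuTilde c C l L D h E d0 d1 d2 k f, ∀ i ∈ Set.Icc n (f n),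
      ‖MPPA.resolvent A (cs i) (z i) - z i‖ ≤ 1 / ((k : ℝ) + 1) := by
    intro k
    set Θ := MPPA.Theta L E d0 d1 d2 (4 * k + 3) with hΘ
    set K := 2 * k + 1 with hK
    set l₀ := l (4 * c * D * (K + 1) - 1) with hl₀
    have hmono : Monotone fun m => f (max (max m l₀) Θ) + 1 := fun m n hmn =>
      Nat.add_le_add_right (hf (max_le_max_right _ (max_le_max_right _ hmn))) 1
    obtain ⟨n, hn, hreg⟩ := MPPA.exists_le_mu hA hp hcs hlam hdel hgam hsum hy hc hh hhm hlm hLm hQ1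
      hQ2 hL hQ4 hD0 hu hyD hCm hC (16 * c ^ 2 * (K + 1) ^ 2 - 1) hmono
    -- The counterfunction passed to `mu` already evaluates `f` at this shifted point, so the
    -- interval beginning here lies inside the one where `y` is regular.
    refine ⟨max (max n l₀) Θ, max_le_max_right _ (max_le_max_right _ hn), fun i hi => ?_⟩
    have h1 := hreg i ⟨((le_max_left _ _).trans (le_max_left _ _)).trans hi.1,
      hi.2.trans (Nat.le_succ _)⟩
    have h2 : K ≤ 16 * c ^ 2 * (K + 1) ^ 2 - 1 := by
      have h3 : 1 ≤ c ^ 2 := Nat.one_le_pow _ _ hc1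
      have h4 : K + 1 ≤ (K + 1) ^ 2 := Nat.le_self_pow two_ne_zero _
      have h5 : (K + 1) ^ 2 ≤ c ^ 2 * (K + 1) ^ 2 := Nat.le_mul_of_pos_left _ h3
      have h6 : 16 * c ^ 2 * (K + 1) ^ 2 = 16 * (c ^ 2 * (K + 1) ^ 2) := by ring
      omega
    have h3 := h1.trans (Nat.one_div_le_one_div h2)
    have h4 := MPPA.norm_sub_le_of_Theta_le hA hne hcs hlam hdel hgam hsum hz hy0 hy hQ3 hQ5 hd2 hd1b
      hd2b (4 * k + 3) ((le_max_right _ _).trans hi.1)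
    have h5 := MPPA.norm_resolvent_sub_self_le_of_close hA hne (hcs i) (y i) (z i)
    have e1 : 1 / ((K : ℝ) + 1) = 1 / 2 * (1 / ((k : ℝ) + 1)) := by
      rw [hK]; push_cast; field_simp; ring
    have e2 : 1 / (((4 * k + 3 : ℕ) : ℝ) + 1) = 1 / 4 * (1 / ((k : ℝ) + 1)) := by
      push_cast; field_simp; ring
    rw [e1] at h3
    rw [e2] at h4
    -- The residual of `y i` contributes `1 / 2` of the target and twice the distance to `z i`
    -- contributes `2 * (1 / 4)`.
    linarith
  refine ⟨hregular k, ?_⟩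
  obtain ⟨n, hn, hreg⟩ := hregular (2 * k + 1)
  refine ⟨n, hn, fun i hi => ?_⟩
  have hcpos : 0 < 1 / (c : ℝ) := one_div_pos.2 (Nat.cast_pos.2 hc1)
  -- Residuals grow with the parameter and `1 / c ≤ cs i`, so the bound for `J_{c_i}` passes
  -- directly to `J_{1/c}`.
  refine (MPPA.norm_resolvent_sub_self_mono hA hne hcpos ((hQ4 i).trans (min_le_left _ _))
    (z i)).trans ((hreg i hi).trans (Nat.one_div_le_one_div ?_))
  omega
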